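/- **Notation.** For integers $a,b$ let $(a:b)=\{a,a+1,\dots,b\}$ (empty if $a>b$), and let $\mathcal I_{n,k}$ be the set of increasing $k$-tuples (equivalently, $k$-element subsets) of $(1:n)$. For a real matrix $X$ with $m$ rows and $n$ columns, $X_{\alpha,\beta}$ is the submatrix with rows $\alpha$ and columns $\beta$, and $X_{[r]}$ is its $r$-th multiplicative compound matrix, i.e. the $\binom mr\times\binom nr$ matrix of the minors $\det X_{I,J}$, $I\in\mathcal I_{m,r}$, $J\in\mathcal I_{n,r}$, in lexicographic order. Let $A\in\mathbb R^{n\times n}$ and let $c\in\mathbb R^{1\times n}$ be a row vector. The observability operator $\mathcal O$ maps $x_0\in\mathbb R^n$ to the sequence $(cA^tx_0)_{t\ge 0}$; $(A,c)$ is observable if $\mathcal O$ is injective; $\mathcal O^N\in\mathbb R^{N\times n}$ is the matrix with rows $c,cA,\dots,cA^{N-1}$. The impulse response of a triple $(A,b,c)$ is $g(t)=cA^{t-1}b$, $t\ge1$; the triple is (strictly) externally positive if $g(t)\ge0$ (resp. $g(t)>0$) for all $t\ge1$, and (strictly) externally negative if the inequality is reversed. The variation $S^-(u)$ of a finite or infinite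 real sequence $u\neq 0$ is the number (possibly $\infty$) of sign changes in $u$ after its zeros are deleted, and $S^-(0)=-1$. A linear map $X$ is $j$-variation bounding if $S^-(Xu)\le j$ for all $u\ne0$ with $S^-(u)\le j$. **Proposition.** Let $(A,c)$ be observable and $k\in(1:n)$. For $r\in(1:k)$ and $\beta\in\mathcal I_{n,k}$ put $$\tilde A_r:=A_{[r]},\qquad \tilde c_r:=(\mathcal O^r)_{[r]},\qquad \tilde b_{k,r,\beta}:=\begin{pmatrix}\left(A^{k-r}(\mathcal O^n)^{-1}\begin{pmatrix}0\\ I_{n-k+r}\end{pmatrix}\right)_{[r]} & 0\end{pmatrix}(\mathcal O^nP_\beta)_{[k]},$$ where $P_\beta:=(I_n)_{(1:n),\beta}$ and the first factor is padded by zero columns to $\binom nk$ columns. 1. For all $r\in(1:k)$, $\beta\in\mathcal I_{n,k}$, $N\ge1$, $t\in(1:N-k+1)$ and $\alpha=(1:k-r)\cup(k-r+t:k+t-1)$, $$\det(\mathcal O^N_{\alpha,\beta})=\tilde c_r\tilde A_r^{\,t-1}\tilde b_{k,r,\beta}.$$ 2. Call $\beta\in\mathcal I_{n,k}$ prescribed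 if $\beta=(1:k-s)\cup(\bar t:\bar t+s-1)$ for some $s\in(1:k)$ and $\bar t\in(k-s+1:n-s+1)$, and exceptional if $\beta=(\bar t:\bar t+k-1)$ for some $\bar t\in(k+1:n-k+1)$. Suppose that for all $r\in(1:k)$: * for every prescribed, non-exceptional $\beta$, $(\tilde A_r,\tilde b_{k,r,\beta},\tilde c_r)$ is strictly externally positive; * for every exceptional $\beta$, $(\tilde A_r,\tilde b_{k,r,\beta},\tilde c_r)$ is externally positive and $\tilde c_r\tilde A_r^{\,l-1}\tilde b_{k,r,\beta}\neq0$ for all $l\in(1:k)$. Or suppose that the same holds with "negative" in place of "positive" for all these $(r,\beta)$. Then $\mathcal O$ is $(k-1)$-variation bounding. -/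

import Mathlib

open Matrix

noncomputable section

/-! ### Variation and variation bounding maps -/

/-- The positions of the sign changes of `u` after deleting its zeros: pairs `i < j` of
indices with entries of opposite strict sign and only zeros strictly in between. -/
def signChanges {ι : Type*} [LinearOrder ι] (u : ι → ℝ) : Set (ι × ι) :=
  {p | p.1 < p.2 ∧ u p.1 * u p.2 < 0 ∧ ∀ l, p.1 < l → l < p.2 → u l = 0}

open scoped Classical in
/-- The variation of a (finite or infinite) sequence, with value `-1` at the zero sequence and
`⊤` if there are infinitely many sign changes. -/
def variation {ι : Type*} [LinearOrder ι] (u : ι → ℝ) : WithTop ℤ :=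
  if u = 0 then ((-1 : ℤ) : WithTop ℤ)
  else ENat.map (fun m : ℕ => (m : ℤ)) (signChanges u).encard

/-- `k`-variation bounding linear maps. -/
def IsVariationBounding {ι κ : Type*} [LinearOrder ι] [LinearOrder κ] (k : ℕ)
    (X : (ι → ℝ) →ₗ[ℝ] (κ → ℝ)) : Prop :=
  ∀ u : ι → ℝ, u ≠ 0 → variation u ≤ ((k : ℤ) : WithTop ℤ) →
    variation (X u) ≤ ((k : ℤ) : WithTop ℤ)

/-! ### Multiplicative compound matrices -/

/-- The increasing `r`-tuples of indices in `Fin n`, inside the lexicographically ordered set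
of all `r`-tuples. -/
def increasingTuples (n r : ℕ) : Finset (Lex (Fin r → Fin n)) :=
  haveI := Classical.decPred fun v : Lex (Fin r → Fin n) => StrictMono (ofLex v)
  Finset.univ.filter fun v => StrictMono (ofLex v)

theorem mem_increasingTuples {n r : ℕ} (v : Lex (Fin r → Fin n)) :
    v ∈ increasingTuples n r ↔ StrictMono (ofLex v) := by
  simp [increasingTuples]

theorem card_increasingTuples (n r : ℕ) : (increasingTuples n r).card = n.choose r := by
  have h : (increasingTuples n r).card
      = (Finset.powersetCard r (Finset.univ : Finset (Fin n))).card := by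
    refine Finset.card_bij (fun v _ => Finset.univ.image (ofLex v)) ?_ ?_ ?_
    · intro v hv
      rw [mem_increasingTuples] at hv
      simp [Finset.mem_powersetCard, Finset.card_image_of_injective _ hv.injective]
    · intro v hv w hw hvw
      rw [mem_increasingTuples] at hv hw
      have h2 : Set.range (ofLex v) = Set.range (ofLex w) := by
        have := congrArg (fun s : Finset (Fin n) => (s : Set (Fin n))) hvw
        simpa using this
      exact ofLex.injective ((StrictMono.range_inj hv hw).1 h2)
    · intro s hs
      rw [Finset.mem_powersetCard] at hs
      refine ⟨toLex (s.orderEmbOfFin hs.2), ?_, ?_⟩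
      · rw [mem_increasingTuples]
        exact (s.orderEmbOfFin hs.2).strictMono
      · apply Finset.coe_injective
        simp
  rw [h, Finset.card_powersetCard, Finset.card_univ, Fintype.card_fin]

/-- The `i`-th increasing `r`-tuple of indices in `Fin n`, in lexicographic order. -/
def lexTuple (n r : ℕ) (i : Fin (n.choose r)) : Fin r → Fin n :=
  ofLex ((increasingTuples n r).orderEmbOfFin (card_increasingTuples n r) i)

/-- The `r`-th multiplicative compound matrix. -/
def compound {m n : ℕ} (X : Matrix (Fin m) (Fin n) ℝ) (r : ℕ) :
    Matrix (Fin (m.choose r)) (Fin (n.choose r)) ℝ :=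
  Matrix.of fun i j => (X.submatrix (lexTuple m r i) (lexTuple n r j)).det

/-- The only index of a row or column of an `r`-th compound that ranges over `r` indices. -/
def onlyIndex (r : ℕ) : Fin (r.choose r) := ⟨0, by simp⟩

/-! ### Observability and external positivity -/

/-- The observability operator `x₀ ↦ (c A ^ t x₀)`, `t ≥ 0`. -/
def obsOperator {n : ℕ} (A : Matrix (Fin n) (Fin n) ℝ) (c : Fin n → ℝ) :
    (Fin n → ℝ) →ₗ[ℝ] (ℕ → ℝ) where
  toFun x t := c ⬝ᵥ ((A ^ t) *ᵥ x)
  map_add' x y := by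
    funext t
    simp [Matrix.mulVec_add]
  map_smul' a x := by
    funext t
    simp [Matrix.mulVec_smul]

/-- `(A, c)` is observable: the output determines the initial state. -/
def IsObservable {n : ℕ} (A : Matrix (Fin n) (Fin n) ℝ) (c : Fin n → ℝ) : Prop :=
  Function.Injective (obsOperator A c)

/-- The finite observability matrix with the `N` rows `c, c A, …, c A ^ (N - 1)`. -/
def obsMatrix {n : ℕ} (A : Matrix (Fin n) (Fin n) ℝ) (c : Fin n → ℝ) (N : ℕ) :
    Matrix (Fin N) (Fin n) ℝ :=
  Matrix.of fun i j => (c ᵥ* (A ^ (i : ℕ))) j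

/-- The impulse response `g(t) = c A ^ (t - 1) b`, `t ≥ 1`, of `(A, b, c)`. -/
def impulseResponse {d : ℕ} (A : Matrix (Fin d) (Fin d) ℝ) (b c : Fin d → ℝ) (t : ℕ) : ℝ :=
  c ⬝ᵥ ((A ^ (t - 1)) *ᵥ b)

def StrictlyExternallyPositive {d : ℕ} (A : Matrix (Fin d) (Fin d) ℝ) (b c : Fin d → ℝ) :
    Prop :=
  ∀ t : ℕ, 1 ≤ t → 0 < impulseResponse A b c t

def StrictlyExternallyNegative {d : ℕ} (A : Matrix (Fin d) (Fin d) ℝ) (b c : Fin d → ℝ) :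
    Prop :=
  ∀ t : ℕ, 1 ≤ t → impulseResponse A b c t < 0

def ExternallyPositive {d : ℕ} (A : Matrix (Fin d) (Fin d) ℝ) (b c : Fin d → ℝ) : Prop :=
  ∀ t : ℕ, 1 ≤ t → 0 ≤ impulseResponse A b c t

def ExternallyNegative {d : ℕ} (A : Matrix (Fin d) (Fin d) ℝ) (b c : Fin d → ℝ) : Prop :=
  ∀ t : ℕ, 1 ≤ t → impulseResponse A b c t ≤ 0

/-! ### The compound systems -/

/-- The block matrix `(0 ; I_m)` with `n` rows. -/
def zeroOverIdentity (n m : ℕ) : Matrix (Fin n) (Fin m) ℝ :=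
  Matrix.of fun i j => if (i : ℕ) = (n - m) + (j : ℕ) then 1 else 0

/-- The block matrix `(M  0)` with `q` columns. -/
def padZeroColumns {d p : ℕ} (M : Matrix (Fin d) (Fin p) ℝ) (q : ℕ) :
    Matrix (Fin d) (Fin q) ℝ :=
  Matrix.of fun i j => if h : (j : ℕ) < p then M i ⟨j, h⟩ else 0

/-- The state matrix `A_[r]`. -/
def systemA {n : ℕ} (A : Matrix (Fin n) (Fin n) ℝ) (r : ℕ) :
    Matrix (Fin (n.choose r)) (Fin (n.choose r)) ℝ :=
  compound A r

/-- The output row `(O^r)_[r]`. -/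
def systemC {n : ℕ} (A : Matrix (Fin n) (Fin n) ℝ) (c : Fin n → ℝ) (r : ℕ) :
    Fin (n.choose r) → ℝ :=
  fun j => compound (obsMatrix A c r) r (onlyIndex r) j

/-- The matrix `P_β` made of the columns of the identity with indices `β`. -/
def columnSelector {n k : ℕ} (β : Fin k → Fin n) : Matrix (Fin n) (Fin k) ℝ :=
  (1 : Matrix (Fin n) (Fin n) ℝ).submatrix id β

/-- The input column
`((A ^ (k - r) (O^n)⁻¹ (0 ; I_{n-k+r}))_[r]  0) (O^n P_β)_[k]`. -/
def systemB {n k : ℕ} (A : Matrix (Fin n) (Fin n) ℝ) (c : Fin n → ℝ) (r : ℕ)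
    (β : Fin k → Fin n) : Fin (n.choose r) → ℝ :=
  fun i =>
    (padZeroColumns
        (compound (A ^ (k - r) * (obsMatrix A c n)⁻¹ * zeroOverIdentity n (n - k + r)) r)
        (n.choose k)
      * compound (obsMatrix A c n * columnSelector β) k) i (onlyIndex k)

/-! ### Index sets -/

/-- The set of entries of a tuple, counted from `1`. -/
def indexSet {k n : ℕ} (v : Fin k → Fin n) : Set ℕ :=
  Set.range fun j => (v j : ℕ) + 1

/-- The increasing `k`-tuples `{(1 : k - s), (t : t + s - 1)}` with `s ∈ (1 : k)` and
`t ∈ (k - s + 1 : n - s + 1)`. -/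
def IsPrescribed {n k : ℕ} (β : Fin k → Fin n) : Prop :=
  StrictMono β ∧ ∃ s t : ℕ, 1 ≤ s ∧ s ≤ k ∧ k - s + 1 ≤ t ∧ t + s ≤ n + 1 ∧
    indexSet β = Set.Icc 1 (k - s) ∪ Set.Icc t (t + s - 1)

/-- The consecutive `k`-tuples `(t : t + k - 1)` with `t ∈ (k + 1 : n - k + 1)`. -/
def IsExceptional {n k : ℕ} (β : Fin k → Fin n) : Prop :=
  StrictMono β ∧ ∃ t : ℕ, k + 1 ≤ t ∧ t + k ≤ n + 1 ∧
    indexSet β = Set.Icc t (t + k - 1)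

end

/-! Part 1 is Cauchy–Binet. With `p = k - r`, factor the chosen `k` rows of `O^N` as `G * O^n`,
where `G` is those rows times `(O^n)⁻¹`. The first `p` rows of `G` are unit vectors, so `det (G *
(O^n P_β))` only receives terms from column tuples that begin with `0, …, p - 1`. These come first
in lexicographic order, which is why `b` is padded by zero columns on the right, and on each of them
`det G` reduces to an `r × r` minor of `O^r A^(t-1) A^p (O^n)⁻¹ (0 ; I)`. Multiplicativity of
compounds turns the sum into an impulse response (`det_obsMatrix_submatrix`).

Part 2 is a total positivity argument. By Part 1 the hypotheses fix the sign of the minors whose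
rows and columns each form an initial segment followed by a consecutive block. A three-term Plücker
relation spreads strict positivity from such index sets to all increasing ones
(`listDet_pos_of_consecutive`), applied to columns and to rows. Only weak signs are needed for
consecutive column blocks that miss the first column: adding `ε ^ j` times the first column to
column `j` makes those minors strict for small `ε > 0` and leaves every minor containing the first
column unchanged (`eventually_listMinor_pos`).

If `O u` had `k` sign changes, `k + 1` of its samples would alternate strictly, and would still do
so after a small perturbation. With all `k × k` minors of one strict sign this is impossible unless
`u` itself has at least `k` sign changes: neighbouring coefficients of equal weak sign are merged
until `k` columns remain, and then a Laplace expansion of a vanishing determinant has all its terms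
of one sign (`sum_smul_not_alternating`). -/

noncomputable section

/-! ### Determinants of lists of vectors -/

/-- The determinant of the matrix whose rows are the first `k` entries of a list. -/
def listDet {k : ℕ} (l : List (Fin k → ℝ)) : ℝ :=
  (Matrix.of fun i : Fin k => l.getD i 0).det

theorem listDet_swap {k : ℕ} (l₁ l₂ : List (Fin k → ℝ)) (x y : Fin k → ℝ)
    (h : l₁.length + 2 ≤ k) :
    listDet (l₁ ++ x :: y :: l₂) = -listDet (l₁ ++ y :: x :: l₂) := by
  set a : Fin k := ⟨l₁.length, by omega⟩ with ha
  set b : Fin k := ⟨l₁.length + 1, by omega⟩ with hb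
  have hab : a ≠ b := by simp [ha, hb]
  have hM : (Matrix.of fun i : Fin k => (l₁ ++ x :: y :: l₂).getD i 0)
      = (Matrix.of fun i : Fin k => (l₁ ++ y :: x :: l₂).getD i 0).submatrix
          (Equiv.swap a b) id := by
    ext i j
    simp only [Matrix.of_apply, Matrix.submatrix_apply, id]
    by_cases hia : i = a
    · subst hia
      simp [ha, hb, List.getD_eq_getElem?_getD]
    by_cases hib : i = b
    · subst hib
      simp [ha, hb, List.getD_eq_getElem?_getD]
    rw [Equiv.swap_apply_of_ne_of_ne hia hib]
    have h1 : (i : ℕ) ≠ l₁.length := fun h => hia (Fin.ext h)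
    have h2 : (i : ℕ) ≠ l₁.length + 1 := fun h => hib (Fin.ext h)
    rcases Nat.lt_or_ge (i : ℕ) l₁.length with h3 | h3
    · simp [List.getD_eq_getElem?_getD, List.getElem?_append_left h3]
    · obtain ⟨q, hq⟩ : ∃ q, (i : ℕ) = l₁.length + (q + 2) := ⟨i - l₁.length - 2, by omega⟩
      have h4 : l₁.length + (q + 2) - l₁.length = q + 2 := by omega
      rw [List.getD_eq_getElem?_getD, List.getD_eq_getElem?_getD, hq,
        List.getElem?_append_right (by omega), List.getElem?_append_right (by omega), h4]
      rfl
  unfold listDet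
  rw [hM, Matrix.det_permute, Equiv.Perm.sign_swap hab]
  simp

theorem listDet_move {k : ℕ} (l₁ l₂ : List (Fin k → ℝ)) (x : Fin k → ℝ)
    (h : l₁.length + 1 ≤ k) :
    listDet (l₁ ++ x :: l₂) = (-1) ^ l₁.length * listDet (x :: (l₁ ++ l₂)) := by
  induction l₁ using List.reverseRecOn generalizing l₂ with
  | nil => simp
  | append_singleton l y ih =>
    simp only [List.length_append, List.length_singleton] at h
    have h1 := listDet_swap l l₂ y x (by omega)
    have h2 := ih (y :: l₂) (by omega)
    simp only [List.append_assoc, List.singleton_append, List.length_append,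
      List.length_singleton]
    rw [h1, h2]
    ring

/-- Both vectors cross `l₁`, so those signs cancel; only the passage of `y` across `l₂` counts. -/
theorem listDet_move_two {k : ℕ} (l₁ l₂ l₃ : List (Fin k → ℝ)) (x y : Fin k → ℝ)
    (h : l₁.length + l₂.length + 2 ≤ k) :
    listDet (l₁ ++ x :: (l₂ ++ y :: l₃)) =
      (-1) ^ l₂.length * listDet (x :: y :: (l₁ ++ l₂ ++ l₃)) := by
  rw [listDet_move _ _ _ (by omega)]
  have h1 := listDet_move (x :: (l₁ ++ l₂)) l₃ y (by simp; omega)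
  have h2 := listDet_swap [] (l₁ ++ l₂ ++ l₃) y x (by simp; omega)
  simp only [List.cons_append, List.append_assoc, List.nil_append, List.length_cons,
    List.length_append] at h1 h2 ⊢
  rw [h1, h2, pow_succ, pow_add]
  have h3 : ((-1 : ℝ) ^ l₁.length) * (-1) ^ l₁.length = 1 := by
    rw [← mul_pow]; simp
  linear_combination ((-1) ^ l₂.length * listDet (x :: y :: (l₁ ++ (l₂ ++ l₃)))) * h3

theorem cons_rows_eq_updateRow {k : ℕ} (x y : Fin (k + 1) → ℝ) (l : List (Fin (k + 1) → ℝ)) :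
    (Matrix.of fun i : Fin (k + 1) => (x :: l).getD i 0) =
      (Matrix.of fun i : Fin (k + 1) => (y :: l).getD i 0).updateRow 0 x := by
  ext i j
  refine Fin.cases ?_ (fun i => ?_) i
  · simp
  · simp

/-- The determinant as a linear function of the head of the list. -/
def headDet {k : ℕ} (l : List (Fin (k + 1) → ℝ)) : (Fin (k + 1) → ℝ) →ₗ[ℝ] ℝ where
  toFun x := listDet (x :: l)
  map_add' x y := by
    unfold listDet
    rw [cons_rows_eq_updateRow (x + y) 0, cons_rows_eq_updateRow x 0,
      cons_rows_eq_updateRow y 0, Matrix.det_updateRow_add]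
  map_smul' a x := by
    unfold listDet
    rw [cons_rows_eq_updateRow (a • x) 0, cons_rows_eq_updateRow x 0,
      Matrix.det_updateRow_smul]
    simp

theorem listDet_append_linear {k : ℕ} (l₁ l₂ : List (Fin k → ℝ)) (x y : Fin k → ℝ) (a b : ℝ)
    (h : l₁.length + 1 ≤ k) :
    listDet (l₁ ++ (a • x + b • y) :: l₂) =
      a * listDet (l₁ ++ x :: l₂) + b * listDet (l₁ ++ y :: l₂) := by
  obtain ⟨j, rfl⟩ : ∃ j, k = j + 1 := ⟨k - 1, by omega⟩
  simp only [listDet_move _ _ _ h]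
  have := (headDet (l₁ ++ l₂)).map_add (a • x) (b • y)
  rw [map_smul, map_smul] at this
  simp only [headDet, LinearMap.coe_mk, AddHom.coe_mk, smul_eq_mul] at this
  rw [this]
  ring

theorem listDet_eq_zero_of_mem {k : ℕ} (x : Fin k → ℝ) (l : List (Fin k → ℝ)) {i : ℕ}
    (hi : i + 1 < k) (h : l.getD i 0 = x) : listDet (x :: l) = 0 := by
  unfold listDet
  refine Matrix.det_zero_of_row_eq (i := ⟨0, by omega⟩) (j := ⟨i + 1, hi⟩) (by simp) ?_
  funext j
  simp only [Matrix.of_apply, List.getD_cons_zero, List.getD_cons_succ, h]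

/-- Cramer's rule writes `det M • b` as a combination of the rows `c, d, l` of `M`. Under `x ↦ det
(x, a, l)` the rows from `l` are repeated and vanish, which leaves three products. -/
theorem listDet_plucker {k : ℕ} (l : List (Fin (k + 2) → ℝ)) (a b c d : Fin (k + 2) → ℝ) :
    listDet (a :: c :: l) * listDet (b :: d :: l) =
      listDet (a :: b :: l) * listDet (c :: d :: l) +
        listDet (a :: d :: l) * listDet (b :: c :: l) := by
  set M : Matrix (Fin (k + 2)) (Fin (k + 2)) ℝ :=
    Matrix.of fun i => (c :: d :: l).getD i 0 with hM
  have h1 := Matrix.mulVec_cramer Mᵀ b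
  have h2 : Mᵀ *ᵥ Matrix.cramer Mᵀ b = ∑ i, (M.updateRow i b).det • M i := by
    funext j
    simp only [Matrix.mulVec, dotProduct, Finset.sum_apply, Pi.smul_apply, smul_eq_mul,
      Matrix.cramer_transpose_apply, Matrix.transpose_apply]
    exact Finset.sum_congr rfl fun i _ => mul_comm _ _
  rw [h2, Matrix.det_transpose] at h1
  have h3 := congrArg (headDet (a :: l)) h1
  rw [map_sum, Fin.sum_univ_succ, Fin.sum_univ_succ] at h3
  simp only [map_smul, smul_eq_mul] at h3
  have h4 : ∑ i : Fin k, (M.updateRow i.succ.succ b).det * headDet (a :: l) (M i.succ.succ)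
      = 0 := by
    refine Finset.sum_eq_zero fun i _ => ?_
    have : headDet (a :: l) (M i.succ.succ) = 0 := by
      refine listDet_eq_zero_of_mem _ _ (i := i + 1) (by omega) ?_
      rfl
    rw [this, mul_zero]
  have h5 : M.updateRow 0 b = Matrix.of fun i : Fin (k + 2) => (b :: d :: l).getD i 0 :=
    (cons_rows_eq_updateRow _ _ _).symm
  have h6 : M.updateRow (Fin.succ 0) b
      = Matrix.of fun i : Fin (k + 2) => (c :: b :: l).getD i 0 := by
    ext i j
    refine Fin.cases ?_ (fun i => Fin.cases ?_ (fun i => ?_) i) i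
    · rw [Matrix.updateRow_ne (Fin.succ_ne_zero 0).symm]
      simp [hM]
    · simp
    · rw [Matrix.updateRow_ne (by simp [Fin.ext_iff])]
      simp [hM]
  rw [h4, h5, h6, add_zero] at h3
  have h7 : headDet (a :: l) (M 0) = listDet (c :: a :: l) := rfl
  have h8 : headDet (a :: l) (M (Fin.succ 0)) = listDet (d :: a :: l) := rfl
  have h9 : headDet (a :: l) b = listDet (b :: a :: l) := rfl
  rw [h7, h8, h9] at h3
  have s1 := listDet_swap [] l c a (by simp)
  have s2 := listDet_swap [] l d a (by simp)
  have s3 := listDet_swap [] l b a (by simp)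
  have s4 := listDet_swap [] l c b (by simp)
  simp only [List.nil_append] at s1 s2 s3 s4
  change listDet (b :: d :: l) * _ + listDet (c :: b :: l) * _ = listDet (c :: d :: l) * _ at h3
  rw [s1, s2, s3, s4] at h3
  linear_combination (-1) * h3

/-! ### Positivity of minors from minors with nearly consecutive indices -/

/-- Supplies the index `c` to insert in the Plücker relation. The entries `b` and `d` are the two
ends of the list, so replacing either one by `c` shrinks its span. -/
theorem eq_range'_or_exists_gap (l : List ℕ) (hl : l.Pairwise (· < ·)) :
    (∃ a, l = List.range' a l.length) ∨
      ∃ b G₁ c G₂ d, l = b :: (G₁ ++ G₂ ++ [d]) ∧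
        (b :: (G₁ ++ c :: G₂ ++ [d])).Pairwise (· < ·) := by
  induction l with
  | nil => exact Or.inl ⟨0, by simp⟩
  | cons b l ih =>
    rw [List.pairwise_cons] at hl
    rcases ih hl.2 with ⟨a, ha⟩ | ⟨b', G₁, c, G₂, d, rfl, h⟩
    · rcases List.eq_nil_or_concat' l with rfl | ⟨G₂, d, rfl⟩
      · exact Or.inl ⟨b, by simp⟩
      by_cases hab : a = b + 1
      · left
        refine ⟨b, ?_⟩
        rw [List.length_cons, List.range'_succ, ← hab, ← ha]
      · right
        refine ⟨b, [], b + 1, G₂, d, by simp, ?_⟩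
        have hmem : ∀ x ∈ G₂ ++ [d], b + 1 < x := by
          intro x hx
          have hab' : b < a := by
            refine hl.1 a ?_
            rw [ha]
            simp
          rw [ha, List.mem_range'_1] at hx
          omega
        simp only [List.nil_append, List.cons_append, List.pairwise_cons]
        refine ⟨?_, hmem, hl.2⟩
        intro x hx
        rcases List.mem_cons.1 hx with rfl | hx
        · omega
        · exact (Nat.lt_succ_self b).trans (hmem x hx)
    · right
      refine ⟨b, b' :: G₁, c, G₂, d, by simp, ?_⟩
      rw [List.pairwise_cons]
      refine ⟨?_, by simpa using h⟩
      have hb' : b < b' := hl.1 b' (by simp)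
      intro x hx
      simp only [List.cons_append, List.mem_cons] at hx
      rcases hx with rfl | hx
      · exact hb'
      · exact hb'.trans ((List.pairwise_cons.1 h).1 x hx)

/-- In the relation `[p c][b d] = [p b][c d] + [p d][b c]`, with the other entries common to all
brackets, every bracket except `[b d]` is already known to be positive. Those with `p` have a longer
initial segment; the other two have a narrower span. -/
theorem listDet_pos_of_consecutive {k : ℕ} (v : ℕ → Fin k → ℝ) (σ : ℝ) (N p₀ : ℕ)
    (hkN : k ≤ N)
    (hbase : ∀ p t, p₀ ≤ p → p ≤ k → k + t ≤ N →
      0 < σ * listDet ((List.range p ++ List.range' (p + t) (k - p)).map v))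
    (p : ℕ) (hp₀ : p₀ ≤ p) (hpk : p ≤ k) (l : List ℕ) (hl : l.Pairwise (· < ·))
    (hlen : l.length = k - p) (hmem : ∀ x ∈ l, p ≤ x ∧ x < N) :
    0 < σ * listDet ((List.range p ++ l).map v) := by
  induction hm : k - p generalizing p l with
  | zero =>
    have : p = k := by omega
    subst this
    have h1 : l = [] := List.length_eq_zero_iff.1 (by omega)
    subst h1
    simpa using hbase p 0 hp₀ le_rfl (by omega)
  | succ m ihp =>
    -- Inner induction on the width `w` of an interval containing `l`; the outer induction is on the
    -- number `k - p` of entries beyond the initial segment.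
    have key : ∀ w e : ℕ, ∀ l : List ℕ, l.Pairwise (· < ·) → l.length = k - p →
        (∀ x ∈ l, p ≤ x ∧ x < N) → (∀ x ∈ l, e ≤ x ∧ x ≤ e + w) →
        0 < σ * listDet ((List.range p ++ l).map v) := by
      intro w
      induction w with
      | zero =>
        intro e l hl hlen hmem hw
        rcases eq_range'_or_exists_gap l hl with ⟨a, ha⟩ | ⟨b, G₁, c, G₂, d, rfl, h⟩
        · have h1 := hmem a (by rw [ha]; simp; omega)
          have h2 := hmem (a + (l.length - 1)) (by rw [ha]; simp; omega)
          rw [ha, hlen]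
          have := hbase p (a - p) hp₀ hpk (by omega)
          rwa [show p + (a - p) = a by omega] at this
        · have h1 := hw b (by simp)
          have h2 := hw d (by simp)
          have h3 := (List.pairwise_cons.1 hl).1 d (by simp)
          omega
      | succ w ihw =>
        intro e l hl hlen hmem hw
        rcases eq_range'_or_exists_gap l hl with ⟨a, ha⟩ | ⟨b, G₁, c, G₂, d, rfl, h⟩
        · have h1 := hmem a (by rw [ha]; simp; omega)
          have h2 := hmem (a + (l.length - 1)) (by rw [ha]; simp; omega)
          rw [ha, hlen]
          have := hbase p (a - p) hp₀ hpk (by omega)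
          rwa [show p + (a - p) = a by omega] at this
        by_cases hpb : p = b
        · subst hpb
          have h1 := ihp (p + 1) (by omega) (by omega) (G₁ ++ G₂ ++ [d])
            (List.pairwise_cons.1 hl).2 (by simp at hlen ⊢; omega)
            (fun x hx => ⟨(List.pairwise_cons.1 hl).1 x hx,
              (hmem x (List.mem_cons_of_mem _ hx)).2⟩) (by omega)
          rw [List.range_succ, List.append_assoc, List.singleton_append] at h1
          exact h1
        · have hbw := hw b (by simp)
          have hdw := hw d (by simp)
          have hpb' : p < b := lt_of_le_of_ne (hmem b (by simp)).1 hpb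
          have hdN := (hmem d (by simp)).2
          have hlt : ∀ x, x ∈ G₁ ++ c :: G₂ → b < x ∧ x < d := by
            intro x hx
            refine ⟨(List.pairwise_cons.1 h).1 x (List.mem_append_left _ hx), ?_⟩
            exact (List.pairwise_append.1 (List.pairwise_cons.1 h).2).2.2 x hx d (by simp)
          have hbd := (List.pairwise_cons.1 hl).1 d (by simp)
          have hs2 : (G₁ ++ c :: G₂ ++ [d]).Pairwise (· < ·) := (List.pairwise_cons.1 h).2
          have hs1 : (G₁ ++ c :: G₂).Pairwise (· < ·) := (List.pairwise_append.1 hs2).1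
          have hs3 : (b :: (G₁ ++ G₂)).Pairwise (· < ·) := by
            refine List.Pairwise.sublist ?_ hl
            simp
          have hs4 : (G₁ ++ G₂ ++ [d]).Pairwise (· < ·) := (List.pairwise_cons.1 hl).2
          have hlen' : G₁.length + G₂.length + 2 = k - p := by
            simp at hlen; omega
          have hbnd : ∀ x, x ∈ b :: (G₁ ++ c :: G₂ ++ [d]) → b ≤ x ∧ x ≤ d := by
            intro x hx
            simp only [List.mem_cons, List.append_assoc, List.cons_append, List.mem_append,
              List.not_mem_nil, or_false] at hx
            have := hlt x
            simp only [List.mem_append, List.mem_cons] at this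
            rcases hx with rfl | hx | rfl | hx | rfl
            · omega
            · have := this (by tauto); omega
            · have := this (by tauto); omega
            · have := this (by tauto); omega
            · omega
          -- Lists that use the entry `p` have initial segment `0, …, p` and fall under the outer
          -- hypothesis.
          have pos1 : ∀ l' : List ℕ, l'.Pairwise (· < ·) → l'.length + 1 = k - p →
              (∀ x ∈ l', x ∈ b :: (G₁ ++ c :: G₂ ++ [d])) →
              0 < σ * listDet ((List.range p ++ p :: l').map v) := by
            intro l' h1 h2 h3
            have h4 := ihp (p + 1) (by omega) (by omega) l' h1 (by omega)
              (fun x hx => by have := hbnd x (h3 x hx); omega) (by omega)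
            rwa [List.range_succ, List.append_assoc, List.singleton_append] at h4
          have ac := pos1 (G₁ ++ c :: G₂) hs1 (by simp; omega) (by intro x hx; simp at hx ⊢; tauto)
          have ab := pos1 (b :: (G₁ ++ G₂)) hs3 (by simp; omega)
            (by intro x hx; simp at hx ⊢; tauto)
          have ad := pos1 (G₁ ++ G₂ ++ [d]) hs4 (by simp; omega)
            (by intro x hx; simp at hx ⊢; tauto)
          have cd := ihw (e + 1) (G₁ ++ c :: G₂ ++ [d]) hs2 (by simp; omega)
            (fun x hx => by have := hbnd x (List.mem_cons_of_mem _ hx); omega)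
            (fun x hx => by
              have h1 := hbnd x (List.mem_cons_of_mem _ hx)
              have h2 := (List.pairwise_cons.1 h).1 x hx
              omega)
          have bc := ihw e (b :: (G₁ ++ c :: G₂))
            ((List.pairwise_cons (R := fun a b : ℕ => a < b)).2 ⟨fun x hx => (hlt x hx).1, hs1⟩)
            (by simp; omega)
            (fun x hx => by
              have h1 := hbnd x (by simp at hx ⊢; tauto)
              omega)
            (fun x hx => by
              rcases List.mem_cons.1 hx with rfl | hx
              · omega
              · have h1 := hlt x hx
                omega)
          obtain ⟨j, rfl⟩ : ∃ j, k = j + 2 := ⟨k - 2, by omega⟩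
          set P := (List.range p).map v with hP
          have hPl : P.length = p := by simp [hP]
          have e1 := listDet_move_two P (G₁.map v) (G₂.map v) (v p) (v c) (by simp; omega)
          have e2 := listDet_move_two P [] (G₁.map v ++ G₂.map v) (v p) (v b) (by simp; omega)
          have e3 := listDet_move_two P (G₁.map v ++ G₂.map v) [] (v p) (v d) (by simp; omega)
          have e4 := listDet_move_two (P ++ G₁.map v) (G₂.map v) [] (v c) (v d)
            (by simp; omega)
          have e5 := listDet_move_two P (G₁.map v) (G₂.map v) (v b) (v c) (by simp; omega)
          have e6 := listDet_move_two P (G₁.map v ++ G₂.map v) [] (v b) (v d) (by simp; omega)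
          have pl := listDet_plucker (P ++ G₁.map v ++ G₂.map v) (v p) (v b) (v c) (v d)
          simp only [List.map_append, List.map_cons, List.map_nil, ← hP, List.append_assoc,
            List.cons_append, List.nil_append, List.append_nil, List.length_append,
            List.length_map, List.length_nil, pow_zero, one_mul, pow_add]
            at ac ab ad cd bc e1 e2 e3 e4 e5 e6 pl ⊢
          rw [e1] at ac
          rw [e2] at ab
          rw [e3] at ad
          rw [e4] at cd
          rw [e5] at bc
          rw [e6]
          set g₁ : ℝ := (-1) ^ G₁.length
          set g₂ : ℝ := (-1) ^ G₂.length
          have h1 := mul_pos ab cd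
          have h2 := mul_pos ad bc
          refine pos_of_mul_pos_right ?_ ac.le
          refine lt_of_lt_of_eq (add_pos h1 h2) ?_
          -- Reordering gives the three products the signs `g₁ * g₁ * g₂`, `g₂` and `g₁ * g₂ * g₁`,
          -- which agree because `g₁ * g₁ = 1`.
          have hg : g₁ * g₁ = 1 := by rw [← mul_pow]; simp
          linear_combination (-(σ * σ * g₂ * g₁ ^ 2)) * pl +
            (σ * σ * g₂) * (listDet (v p :: v b :: (P ++ (G₁.map v ++ G₂.map v)))
              * listDet (v c :: v d :: (P ++ (G₁.map v ++ G₂.map v)))) * (-hg)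
    exact key N 0 l hl hlen hmem fun x hx => by have := hmem x hx; omega

/-! ### Combinations of columns with positive minors -/

theorem listDet_eq_zero_of_mem' {k : ℕ} (x : Fin (k + 1) → ℝ) (l : List (Fin (k + 1) → ℝ))
    (hl : l.length = k) (h : x ∈ l) : listDet (x :: l) = 0 := by
  obtain ⟨i, hi, rfl⟩ := List.mem_iff_getElem.1 h
  exact listDet_eq_zero_of_mem _ _ (i := i) (by omega) (List.getD_eq_getElem _ _ hi)

theorem listDet_cons_expand {k : ℕ} (y : Fin (k + 1) → ℝ) (l : List (Fin (k + 1) → ℝ)) :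
    listDet (y :: l) =
      ∑ i : Fin (k + 1), (-1) ^ (i : ℕ) * y i * listDet (l.map fun x => x ∘ i.succAbove) := by
  unfold listDet
  rw [Matrix.det_succ_row_zero]
  refine Finset.sum_congr rfl fun i _ => ?_
  congr 2
  ext a b
  simp only [Matrix.submatrix_apply, Matrix.of_apply, Fin.val_succ, List.getD_cons_succ]
  rcases Nat.lt_or_ge (a : ℕ) l.length with h | h
  · rw [List.getD_eq_getElem _ _ h, List.getD_eq_getElem _ _ (by simpa using h)]
    simp
  · rw [List.getD_eq_default _ _ h, List.getD_eq_default _ _ (by simpa using h)]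
    simp

/-- A combination `y` of the `k` columns makes `det (y, columns)` vanish. If `y` alternated, every
term of the expansion along `y` would have the same strict sign. -/
theorem sum_smul_not_alternating_aux {k : ℕ} (hk : 1 ≤ k) (σ : ℝ)
    (C : List ((Fin (k + 1) → ℝ) × ℝ)) (hlen : C.length = k)
    (hpos : ∀ i : Fin (k + 1),
      0 < σ * listDet ((C.map Prod.fst).map fun x => x ∘ i.succAbove)) :
    ¬ ∀ i : Fin k, (C.map fun q => q.2 • q.1).sum i.castSucc *
      (C.map fun q => q.2 • q.1).sum i.succ < 0 := by
  intro halt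
  set y := (C.map fun q => q.2 • q.1).sum with hy
  have h0 : listDet (y :: C.map Prod.fst) = 0 := by
    change headDet (C.map Prod.fst) y = 0
    rw [hy, map_list_sum, List.map_map]
    refine List.sum_eq_zero fun x hx => ?_
    obtain ⟨q, hq, rfl⟩ := List.mem_map.1 hx
    simp only [Function.comp_apply, map_smul]
    have : headDet (C.map Prod.fst) q.1 = 0 :=
      listDet_eq_zero_of_mem' _ _ (by simpa using hlen) (List.mem_map_of_mem hq)
    rw [this, smul_zero]
  rw [listDet_cons_expand] at h0
  obtain ⟨j, rfl⟩ : ∃ j, k = j + 1 := ⟨k - 1, by omega⟩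
  have hz : ∀ i : Fin (j + 1 + 1), 0 < y 0 * ((-1) ^ (i : ℕ) * y i) := by
    intro i
    induction i using Fin.induction with
    | zero =>
      have h1 : y 0 ≠ 0 := by
        intro h
        have := halt 0
        simp [h] at this
      simpa using mul_self_pos.2 h1
    | succ i ih =>
      have h1 := halt i
      have h2 : 0 < y 0 * ((-1) ^ (i.castSucc : ℕ) * y i.castSucc) *
          (-(y i.castSucc * y i.succ)) := mul_pos ih (by linarith)
      have h3 : y i.castSucc ≠ 0 := by
        intro h
        simp [h] at h1
      have h4 : 0 < y i.castSucc * y i.castSucc := mul_self_pos.2 h3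
      refine pos_of_mul_pos_right (a := y i.castSucc * y i.castSucc) ?_ h4.le
      refine lt_of_lt_of_eq h2 ?_
      simp only [Fin.val_castSucc, Fin.val_succ, pow_succ]
      ring
  have h1 : 0 < ∑ i : Fin (j + 1 + 1), (y 0 * ((-1) ^ (i : ℕ) * y i)) *
      (σ * listDet ((C.map Prod.fst).map fun x => x ∘ i.succAbove)) :=
    Finset.sum_pos (fun i _ => mul_pos (hz i) (hpos i)) Finset.univ_nonempty
  refine h1.ne' ?_
  calc _ = y 0 * σ * ∑ i : Fin (j + 1 + 1), (-1) ^ (i : ℕ) * y i *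
        listDet ((C.map Prod.fst).map fun x => x ∘ i.succAbove) := by
        rw [Finset.mul_sum]
        exact Finset.sum_congr rfl fun i _ => by ring
    _ = 0 := by rw [h0, mul_zero]

/-- Two numbers of the same weak sign are nonnegative multiples of one of them, with factors
that are not both zero. -/
theorem exists_common_factor (a b : ℝ) (h : 0 ≤ a * b) :
    ∃ s t c : ℝ, 0 ≤ s ∧ 0 ≤ t ∧ 0 < s + t ∧ a = s * c ∧ b = t * c ∧ (c = a ∨ c = b) := by
  by_cases ha : a = 0
  · exact ⟨0, 1, b, le_rfl, zero_le_one, by norm_num, by simp [ha], by simp, Or.inr rfl⟩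
  · refine ⟨1, b / a, a, zero_le_one, ?_, ?_, by simp, by field_simp, Or.inl rfl⟩
    · have : b / a = a * b / (a * a) := by field_simp
      rw [this]
      exact div_nonneg h (mul_self_nonneg a)
    · have : b / a = a * b / (a * a) := by field_simp
      rw [this]
      exact add_pos_of_pos_of_nonneg one_pos (div_nonneg h (mul_self_nonneg a))

/-- With more than `k` columns, some neighbouring coefficients satisfy `a * b ≥ 0`. Their columns
merge into one nonnegative combination, which keeps the minors positive by multilinearity and the
sum unchanged. -/
theorem sum_smul_not_alternating {k : ℕ} (hk : 1 ≤ k) (σ : ℝ)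
    (C : List ((Fin (k + 1) → ℝ) × ℝ)) (hlen : k ≤ C.length)
    (hpos : ∀ i : Fin (k + 1), ∀ m : List (Fin (k + 1) → ℝ), m.Sublist (C.map Prod.fst) →
      m.length = k → 0 < σ * listDet (m.map fun x => x ∘ i.succAbove))
    (halt : ∀ m : List ℝ, m.Sublist (C.map Prod.snd) → m.length = k + 1 →
      ¬ m.IsChain fun a b => a * b < 0) :
    ¬ ∀ i : Fin k, (C.map fun q => q.2 • q.1).sum i.castSucc *
      (C.map fun q => q.2 • q.1).sum i.succ < 0 := by
  induction hn : C.length generalizing C with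
  | zero => omega
  | succ n ih =>
    rcases hlen.eq_or_lt with heq | hlt
    · exact sum_smul_not_alternating_aux hk σ C heq.symm
        fun i => hpos i _ (List.Sublist.refl _) (by simp [← heq])
    have hC : ¬ (C.map Prod.snd).IsChain fun a b => a * b < 0 := by
      intro h
      exact halt _ (List.take_sublist (k + 1) _) (by simp; omega) (h.take _)
    rw [List.isChain_map, List.isChain_iff_forall_rel_of_append_cons_cons] at hC
    push Not at hC
    obtain ⟨⟨x, a⟩, ⟨y, b⟩, C₁, C₂, rfl, hab⟩ := hC
    obtain ⟨s, t, c, hs, ht, hst, rfl, rfl, hc⟩ := exists_common_factor a b hab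
    simp only [List.length_append, List.length_cons] at hn hlt
    have := ih (C₁ ++ (s • x + t • y, c) :: C₂) (by simp; omega) ?_ ?_ (by simp; omega)
    · have e : ((C₁ ++ (x, s * c) :: (y, t * c) :: C₂).map fun q => q.2 • q.1).sum =
          ((C₁ ++ (s • x + t • y, c) :: C₂).map fun q => q.2 • q.1).sum := by
        simp only [List.map_append, List.map_cons, List.sum_append, List.sum_cons, smul_add,
          smul_smul, mul_comm c, add_assoc]
      rwa [e]
    · intro i m hm hml
      rw [List.map_append, List.map_cons, List.sublist_append_iff] at hm
      obtain ⟨m₁, m₂, rfl, h₁, h₂⟩ := hm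
      rw [List.sublist_cons_iff] at h₂
      rcases h₂ with h₂ | ⟨m₃, rfl, h₂⟩
      · refine hpos i _ ?_ hml
        rw [List.map_append]
        exact h₁.append ((h₂.cons _).cons _)
      · have e : ((s • x + t • y) ∘ i.succAbove) =
            s • (x ∘ i.succAbove) + t • (y ∘ i.succAbove) := rfl
        simp only [List.length_append, List.length_cons] at hml
        rw [List.map_append, List.map_cons, e, listDet_append_linear _ _ _ _ _ _ (by simp; omega)]
        have hx := hpos i (m₁ ++ x :: m₃)
          (by rw [List.map_append]; exact h₁.append ((h₂.cons _).cons_cons _)) (by simpa using hml)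
        have hy := hpos i (m₁ ++ y :: m₃)
          (by rw [List.map_append]; exact h₁.append ((h₂.cons_cons _).cons _)) (by simpa using hml)
        rw [List.map_append, List.map_cons] at hx hy
        rw [mul_add, mul_left_comm, mul_left_comm σ t]
        rcases hs.eq_or_lt with rfl | hs
        · have := mul_pos (by linarith : 0 < t) hy
          linarith
        · have := mul_pos hs hx
          have := mul_nonneg ht hy.le
          linarith
    · intro m hm hml
      refine halt m ?_ hml
      refine hm.trans ?_
      simp only [List.map_append, List.map_cons]
      refine List.Sublist.append (List.Sublist.refl _) ?_
      -- The merged coefficient `c` is one of the two old ones, so the new coefficients form a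
      -- sublist of the old.
      rcases hc with hc | hc
      · rw [← hc]
        exact ((List.Sublist.refl _).cons _).cons_cons _
      · rw [← hc]
        exact (List.Sublist.refl _).cons _

/-! ### Variation and alternating subsequences -/

/-- A nonzero entry strictly between has sign opposite to one of the two ends, so the interval can
be shortened. -/
theorem exists_signChange_between {n : ℕ} (u : Fin n → ℝ) (a b : Fin n) (hab : a < b)
    (h : u a * u b < 0) : ∃ p ∈ signChanges u, a ≤ p.1 ∧ p.2 ≤ b := by
  induction hd : (b : ℕ) - a using Nat.strong_induction_on generalizing a b with
  | _ d ih =>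
    by_cases hz : ∀ l, a < l → l < b → u l = 0
    · exact ⟨(a, b), ⟨hab, h, hz⟩, le_rfl, le_rfl⟩
    · push Not at hz
      obtain ⟨c, hac, hcb, hc⟩ := hz
      have h1 : (a : ℕ) < c := hac
      have h2 : (c : ℕ) < b := hcb
      rcases lt_or_ge (u a * u c) 0 with h3 | h3
      · obtain ⟨p, hp, hpa, hpc⟩ := ih _ (by omega) a c hac h3 rfl
        exact ⟨p, hp, hpa, hpc.trans hcb.le⟩
      · have h4 : u c * u b < 0 := by
          have h5 : 0 < u c * u c := mul_self_pos.2 hc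
          have h6 : u a ≠ 0 := by
            intro h0
            simp [h0] at h
          have h7 : 0 < u a * u c := lt_of_le_of_ne h3 (mul_ne_zero h6 hc).symm
          have h8 : 0 < u a * u c * -(u a * u b) := mul_pos h7 (by linarith)
          have h9 : 0 < u a * u a := mul_self_pos.2 h6
          have : 0 < -(u c * u b) := by
            refine pos_of_mul_pos_right (a := u a * u a) ?_ h9.le
            linarith
          linarith
        obtain ⟨p, hp, hpc, hpb⟩ := ih _ (by omega) c b hcb h4 rfl
        exact ⟨p, hp, hac.le.trans hpc, hpb⟩

theorem length_le_encard_signChanges {n : ℕ} (u : Fin n → ℝ) (a : Fin n) (l : List (Fin n))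
    (hl : (a :: l).Pairwise (· < ·)) (h : (a :: l).IsChain fun x y => u x * u y < 0) :
    (l.length : ℕ∞) ≤ {p ∈ signChanges u | a ≤ p.1}.encard := by
  induction l generalizing a with
  | nil => simp
  | cons b l ih =>
    rw [List.isChain_cons_cons] at h
    rw [List.pairwise_cons] at hl
    have hab := hl.1 b (by simp)
    obtain ⟨p, hp, hpa, hpb⟩ := exists_signChange_between u a b hab h.1
    have h1 := ih b hl.2 h.2
    have h2 : p ∉ {p ∈ signChanges u | b ≤ p.1} := fun h3 =>
      absurd (h3.2.trans_lt (hp.1.trans_le hpb)) (lt_irrefl _)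
    have h3 : insert p {p ∈ signChanges u | b ≤ p.1} ⊆ {p ∈ signChanges u | a ≤ p.1} := by
      rintro q (rfl | hq)
      · exact ⟨hp, hpa⟩
      · exact ⟨hq.1, hab.le.trans hq.2⟩
    calc ((b :: l).length : ℕ∞) = l.length + 1 := by simp
      _ ≤ {p ∈ signChanges u | b ≤ p.1}.encard + 1 := by gcongr
      _ = (insert p {p ∈ signChanges u | b ≤ p.1}).encard := (Set.encard_insert_of_notMem h2).symm
      _ ≤ _ := Set.encard_le_encard h3

/-- Distinct sign changes occupy intervals that overlap at most in endpoints. The list is decreasing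
and is extended at its head by the change with the largest first coordinate. Since `T` may skip sign
changes, `u p.1` and `u q.2` can have opposite signs; then `p.1` is inserted as well. -/
theorem exists_alternating_list {ι : Type*} [LinearOrder ι] (u : ι → ℝ) (T : Finset (ι × ι))
    (hT : ↑T ⊆ signChanges u) (hne : T.Nonempty) :
    ∃ p ∈ T, ∃ L : List ι, T.card ≤ L.length ∧
      (p.2 :: L).IsChain fun x y => y < x ∧ u x * u y < 0 := by
  classical
  induction T using Finset.induction_on_max_value (fun p : ι × ι => p.1) with
  | empty => exact absurd hne Finset.not_nonempty_empty
  | insert p T hp hmax ih =>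
    have hpS : p ∈ signChanges u := hT (by simp)
    rcases T.eq_empty_or_nonempty with rfl | hTne
    · refine ⟨p, by simp, [p.1], by simp, ?_⟩
      simpa [mul_comm] using ⟨hpS.1, hpS.2.1⟩
    obtain ⟨q, hq, L, hcard, hch⟩ := ih (fun x hx => hT (by simp [Finset.mem_coe.1 hx])) hTne
    have hqS : q ∈ signChanges u := hT (by simp [hq])
    have hqp : q.1 < p.1 := by
      refine lt_of_le_of_ne (hmax q hq) fun h => ?_
      have h2 : q.2 = p.2 := by
        rcases lt_trichotomy q.2 p.2 with h3 | h3 | h3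
        · have := hpS.2.2 q.2 (h ▸ hqS.1) h3
          have h4 := hqS.2.1
          simp [this] at h4
        · exact h3
        · have := hqS.2.2 p.2 (h ▸ hpS.1) h3
          have h4 := hpS.2.1
          simp [this] at h4
      exact hp (by rwa [← Prod.ext h h2])
    have hqp2 : q.2 ≤ p.1 := by
      by_contra! h
      have := hqS.2.2 p.1 hqp h
      have h4 := hpS.2.1
      simp [this] at h4
    have hp0 : u p.1 ≠ 0 := fun h => by
      have h4 := hpS.2.1
      simp [h] at h4
    have hq0 : u q.2 ≠ 0 := fun h => by
      have h4 := hqS.2.1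
      simp [h] at h4
    refine ⟨p, by simp, ?_⟩
    rw [Finset.card_insert_of_notMem hp]
    rcases lt_or_ge (u p.1 * u q.2) 0 with h | h
    · refine ⟨p.1 :: q.2 :: L, by simp; omega, ?_⟩
      have hne : q.2 ≠ p.1 := by
        intro h2
        rw [h2] at h
        exact absurd h (not_lt.2 (mul_self_nonneg _))
      rw [List.isChain_cons_cons, List.isChain_cons_cons]
      exact ⟨⟨hpS.1, by rw [mul_comm]; exact hpS.2.1⟩, ⟨lt_of_le_of_ne hqp2 hne, h⟩, hch⟩
    · refine ⟨q.2 :: L, by simpa using hcard, ?_⟩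
      rw [List.isChain_cons_cons]
      refine ⟨⟨hqp2.trans_lt hpS.1, ?_⟩, hch⟩
      have h1 : 0 < u p.1 * u q.2 := lt_of_le_of_ne h (mul_ne_zero hp0 hq0).symm
      have h2 : 0 < u p.1 * u p.1 := mul_self_pos.2 hp0
      have h3 : 0 < u p.1 * u q.2 * -(u p.1 * u p.2) :=
        mul_pos h1 (by have := hpS.2.1; linarith)
      have : 0 < -(u p.2 * u q.2) := by
        refine pos_of_mul_pos_right (a := u p.1 * u p.1) ?_ h2.le
        linarith
      linarith

theorem exists_alternating_of_le_encard {ι : Type*} [LinearOrder ι] (u : ι → ℝ) {k : ℕ}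
    (hk : 1 ≤ k) (h : (k : ℕ∞) ≤ (signChanges u).encard) :
    ∃ s : Fin (k + 1) → ι, StrictMono s ∧ ∀ i : Fin k, u (s i.castSucc) * u (s i.succ) < 0 := by
  obtain ⟨T, hT, hcard⟩ := Set.exists_subset_encard_eq h
  lift T to Finset (ι × ι) using Set.finite_of_encard_eq_coe hcard
  rw [Set.encard_coe_eq_coe_finsetCard, Nat.cast_inj] at hcard
  obtain ⟨p, -, L, hL, hch⟩ := exists_alternating_list u T hT (Finset.card_pos.1 (by omega))
  rw [List.isChain_iff_getElem] at hch
  have hlen : k + 1 ≤ (p.2 :: L).length := by simp; omega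
  -- The list is decreasing, hence the reversed index.
  refine ⟨fun i => (p.2 :: L)[k - (i : ℕ)]'(by omega), ?_, fun i => ?_⟩
  · refine Fin.strictMono_iff_lt_succ.2 fun i => ?_
    have h1 := (hch (k - (i.succ : ℕ)) (by simp at hlen ⊢; omega)).1
    simp only [Fin.val_succ, Fin.val_castSucc, show k - ((i : ℕ) + 1) + 1 = k - i by omega] at h1 ⊢
    exact h1
  · have h1 := (hch (k - (i.succ : ℕ)) (by simp at hlen ⊢; omega)).2
    simp only [Fin.val_succ, Fin.val_castSucc, show k - ((i : ℕ) + 1) + 1 = k - i by omega] at h1 ⊢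
    rwa [mul_comm]

theorem variation_le_iff {ι : Type*} [LinearOrder ι] (u : ι → ℝ) (k : ℕ) :
    variation u ≤ ((k : ℤ) : WithTop ℤ) ↔ (signChanges u).encard ≤ k := by
  unfold variation
  split_ifs with h
  · subst h
    have : signChanges (0 : ι → ℝ) = ∅ := by
      ext p
      simp [signChanges]
    rw [this]
    simp only [Set.encard_empty, zero_le, iff_true]
    exact WithTop.coe_le_coe.2 (by omega)
  · generalize (signChanges u).encard = e
    cases e with
    | top => simp
    | coe m => simp

/-! ### Minors of doubly indexed families -/

/-- The minor of order `k` of a doubly indexed family with rows `l` and columns `m`. -/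
def listMinor (k : ℕ) (X : ℕ → ℕ → ℝ) (l m : List ℕ) : ℝ :=
  (Matrix.of fun i j : Fin k => X (l.getD i 0) (m.getD j 0)).det

theorem listMinor_eq_rows {k : ℕ} (X : ℕ → ℕ → ℝ) (l m : List ℕ) (hl : l.length = k) :
    listMinor k X l m = listDet (l.map fun i (j : Fin k) => X i (m.getD j 0)) := by
  unfold listMinor listDet
  congr 1
  ext i j
  have : (i : ℕ) < l.length := hl ▸ i.2
  simp [List.getD_eq_getElem?_getD, List.getElem?_eq_getElem this]

theorem listMinor_eq_cols {k : ℕ} (X : ℕ → ℕ → ℝ) (l m : List ℕ) (hm : m.length = k) :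
    listMinor k X l m = listDet (m.map fun j (i : Fin k) => X (l.getD i 0) j) := by
  unfold listMinor listDet
  rw [← Matrix.det_transpose]
  congr 1
  ext i j
  have : (i : ℕ) < m.length := hm ▸ i.2
  simp [List.getD_eq_getElem?_getD, List.getElem?_eq_getElem this]

theorem range_append_range'_self {k : ℕ} (hk : 1 ≤ k) :
    List.range k = List.range (k - 1) ++ List.range' (k - 1 + 0) (k - (k - 1)) := by
  obtain ⟨j, rfl⟩ : ∃ j, k = j + 1 := ⟨k - 1, by omega⟩
  simp [List.range_succ]

theorem getD_range' (t k i : ℕ) (hi : i < k) : (List.range' t k).getD i 0 = t + i := by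
  rw [List.getD_eq_getElem _ _ (by simpa using hi), List.getElem_range', one_mul]

theorem listMinor_pos_of_rows {k : ℕ} (hk : 1 ≤ k) (X : ℕ → ℕ → ℝ) (σ : ℝ) (N : ℕ) (hN : k ≤ N)
    (m : List ℕ)
    (h : ∀ p t, p < k → k + t ≤ N →
      0 < σ * listMinor k X (List.range p ++ List.range' (p + t) (k - p)) m)
    (l : List ℕ) (hl : l.Pairwise (· < ·)) (hlen : l.length = k) (hmem : ∀ x ∈ l, x < N) :
    0 < σ * listMinor k X l m := by
  rw [listMinor_eq_rows _ _ _ hlen]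
  refine listDet_pos_of_consecutive _ σ N 0 hN ?_ 0 le_rfl (Nat.zero_le _) l hl (by simpa)
    fun x hx => ⟨Nat.zero_le _, hmem x hx⟩
  intro p t _ hp ht
  rw [← listMinor_eq_rows _ _ _ (by simp; omega)]
  rcases hp.lt_or_eq with hp | rfl
  · exact h p t hp ht
  -- The full initial segment also arises as an initial segment of length `k - 1` followed by a
  -- block of length one.
  · have := h (p - 1) 0 (by omega) (by omega)
    rw [← range_append_range'_self hk] at this
    simpa using this

/-- The parameter `p₀` is used with two values: `p₀ = 1` covers the minors containing column `0`,
where strict signs are given, and `p₀ = 0` covers all minors once the perturbation is made. -/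
theorem listMinor_pos_of_cols {k : ℕ} (hk : 1 ≤ k) (X : ℕ → ℕ → ℝ) (σ : ℝ) (n : ℕ) (hn : k ≤ n)
    (l : List ℕ) (p₀ : ℕ) (hp₀ : p₀ ≤ k)
    (h : ∀ p t, p < k → p₀ ≤ p ∨ t = 0 → k + t ≤ n →
      0 < σ * listMinor k X l (List.range p ++ List.range' (p + t) (k - p)))
    (m : List ℕ) (hm : m.Pairwise (· < ·)) (hlen : m.length = k - p₀)
    (hmem : ∀ x ∈ m, p₀ ≤ x ∧ x < n) :
    0 < σ * listMinor k X l (List.range p₀ ++ m) := by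
  rw [listMinor_eq_cols _ _ _ (by simp; omega)]
  refine listDet_pos_of_consecutive _ σ n p₀ hn ?_ p₀ le_rfl hp₀ m hm hlen hmem
  intro p t hpp hp ht
  rw [← listMinor_eq_cols _ _ _ (by simp; omega)]
  rcases hp.lt_or_eq with hp | rfl
  · exact h p t hp (Or.inl hpp) ht
  · have := h (p - 1) 0 (by omega) (Or.inr rfl) (by omega)
    rw [← range_append_range'_self hk] at this
    simpa using this

/-! ### Adding multiples of the first column -/

/-- Add `ε ^ j` times the first column to every other column `j`. -/
def addFirstColumn (X : ℕ → ℕ → ℝ) (ε : ℝ) (i j : ℕ) : ℝ :=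
  X i j + (if j = 0 then 0 else ε ^ j) * X i 0

theorem continuous_addFirstColumn (X : ℕ → ℕ → ℝ) (i j : ℕ) :
    Continuous fun ε => addFirstColumn X ε i j := by
  unfold addFirstColumn
  split_ifs <;> fun_prop

theorem addFirstColumn_zero (X : ℕ → ℕ → ℝ) : addFirstColumn X 0 = X := by
  ext i j
  unfold addFirstColumn
  split_ifs with h <;> simp [h]

theorem det_eq_of_forall_col_eq_smul_add_const {k : ℕ} {A B : Matrix (Fin k) (Fin k) ℝ}
    (c : Fin k → ℝ) (q : Fin k) (hq : c q = 0) (h : ∀ i j, A i j = B i j + c j * B i q) :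
    A.det = B.det := by
  rw [← Matrix.det_transpose A, ← Matrix.det_transpose B]
  exact Matrix.det_eq_of_forall_row_eq_smul_add_const c q hq fun i j => h j i

theorem listMinor_addFirstColumn_of_head {k : ℕ} (X : ℕ → ℕ → ℝ) (ε : ℝ) (l m : List ℕ) :
    listMinor k (addFirstColumn X ε) l (0 :: m) = listMinor k X l (0 :: m) := by
  unfold listMinor
  rcases k with _ | k
  · simp
  refine det_eq_of_forall_col_eq_smul_add_const
    -- Positions past the end of the list default to column `0`, which is not altered, so no length
    -- hypothesis is needed.
    (fun j : Fin (k + 1) => if (0 :: m).getD j 0 = 0 then 0 else ε ^ ((0 :: m).getD j 0))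
    0 (by simp) fun i j => ?_
  simp only [Matrix.of_apply, addFirstColumn, Fin.val_zero, List.getD_cons_zero]

/-- Border `B` by the column `u` and the row `(1, -c)`. Column operations clear `-c` and turn `B`
into the rank-one update; both bordered determinants are expanded along the first row. -/
theorem det_add_rank_one {k : ℕ} (B : Matrix (Fin (k + 1)) (Fin (k + 1)) ℝ)
    (c u : Fin (k + 1) → ℝ) :
    (Matrix.of fun i j => B i j + c j * u i).det =
      B.det + ∑ j : Fin (k + 1), (-1) ^ (j : ℕ) * c j *
        (Matrix.of fun i => (Fin.cons (u i) fun q => B i (j.succAbove q) :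
          Fin (k + 1) → ℝ)).det := by
  set M : Matrix (Fin (k + 2)) (Fin (k + 2)) ℝ :=
    Matrix.of (Fin.cons (Fin.cons 1 fun j => -c j) fun i => Fin.cons (u i) (B i)) with hM
  set M' : Matrix (Fin (k + 2)) (Fin (k + 2)) ℝ :=
    Matrix.of (Fin.cons (Fin.cons 1 fun _ => 0) fun i => Fin.cons (u i) fun j =>
      B i j + c j * u i) with hM'
  have h1 : M'.det = M.det := by
    refine det_eq_of_forall_col_eq_smul_add_const (Fin.cons 0 c) 0 (by simp) fun i j => ?_
    refine Fin.cases ?_ (fun i => ?_) i <;> refine Fin.cases ?_ (fun j => ?_) j <;>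
      simp [hM, hM']
  rw [Matrix.det_succ_row_zero, Matrix.det_succ_row_zero M, Fin.sum_univ_succ,
    Fin.sum_univ_succ (fun j => _ * M 0 j * _)] at h1
  have h2 : ∀ j : Fin (k + 1), (-1) ^ (j.succ : ℕ) * M' 0 j.succ *
      (M'.submatrix Fin.succ j.succ.succAbove).det = 0 := by
    intro j
    simp [hM']
  have h3 : M'.submatrix Fin.succ (Fin.succAbove 0) = Matrix.of fun i j => B i j + c j * u i := by
    ext i j
    simp [hM']
  have h4 : M.submatrix Fin.succ (Fin.succAbove 0) = B := by
    ext i j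
    simp [hM]
  have h5 : ∀ j : Fin (k + 1), M.submatrix Fin.succ j.succ.succAbove =
      Matrix.of fun i => (Fin.cons (u i) fun q => B i (j.succAbove q) : Fin (k + 1) → ℝ) := by
    intro j
    ext i q
    refine Fin.cases ?_ (fun q => ?_) q <;> simp [hM]
  rw [Finset.sum_eq_zero fun j _ => h2 j, h3, h4] at h1
  simp only [h5] at h1
  have h6 : M' 0 0 = 1 := rfl
  have h7 : M 0 0 = 1 := rfl
  have h8 : ∀ j : Fin (k + 1), M 0 j.succ = -c j := fun j => rfl
  simp only [h6, h7, h8, Fin.val_zero, pow_zero, one_mul, add_zero, Fin.val_succ, pow_succ] at h1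
  rw [h1]
  congr 1
  exact Finset.sum_congr rfl fun j _ => by ring

/-- The weights `ε ^ j` make replacement of the first column of the block dominate: the increment is
`ε ^ t` times a polynomial whose value at `0` is the positive minor on columns `0, t + 1, …, t + k -
1`. -/
theorem eventually_listMinor_addFirstColumn_pos {k : ℕ} (hk : 1 ≤ k) (X : ℕ → ℕ → ℝ) (σ : ℝ)
    (l : List ℕ) (t : ℕ) (ht : 1 ≤ t) (h0 : 0 ≤ σ * listMinor k X l (List.range' t k))
    (h1 : 0 < σ * listMinor k X l (0 :: List.range' (t + 1) (k - 1))) :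
    ∀ᶠ ε in nhdsWithin (0 : ℝ) (Set.Ioi 0),
      0 < σ * listMinor k (addFirstColumn X ε) l (List.range' t k) := by
  obtain ⟨j, rfl⟩ : ∃ j, k = j + 1 := ⟨k - 1, by omega⟩
  set D : Fin (j + 1) → ℝ := fun b => (Matrix.of fun i : Fin (j + 1) =>
    (Fin.cons (X (l.getD i 0) 0) fun q => X (l.getD i 0) (t + b.succAbove q) :
      Fin (j + 1) → ℝ)).det with hD
  have hexp : ∀ ε, σ * listMinor (j + 1) (addFirstColumn X ε) l (List.range' t (j + 1)) =
      σ * listMinor (j + 1) X l (List.range' t (j + 1)) +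
        ε ^ t * ∑ b : Fin (j + 1), (-1) ^ (b : ℕ) * ε ^ (b : ℕ) * (σ * D b) := by
    intro ε
    have := det_add_rank_one (Matrix.of fun i b : Fin (j + 1) => X (l.getD i 0) (t + b))
      (fun b => ε ^ (t + (b : ℕ))) (fun i => X (l.getD i 0) 0)
    have e1 : listMinor (j + 1) (addFirstColumn X ε) l (List.range' t (j + 1)) =
        (Matrix.of fun i b : Fin (j + 1) => X (l.getD i 0) (t + b) +
          ε ^ (t + (b : ℕ)) * X (l.getD i 0) 0).det := by
      unfold listMinor
      congr 1
      ext i b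
      have : t + (b : ℕ) ≠ 0 := by omega
      rw [Matrix.of_apply, Matrix.of_apply, addFirstColumn, getD_range' _ _ _ b.2, if_neg this]
    have e2 : listMinor (j + 1) X l (List.range' t (j + 1)) =
        (Matrix.of fun i b : Fin (j + 1) => X (l.getD i 0) (t + b)).det := by
      unfold listMinor
      congr 1
      ext i b
      rw [Matrix.of_apply, Matrix.of_apply, getD_range' _ _ _ b.2]
    simp only [Matrix.of_apply] at this
    rw [e1, e2, this, mul_add, Finset.mul_sum, Finset.mul_sum]
    congr 1
    refine Finset.sum_congr rfl fun b _ => ?_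
    rw [pow_add]
    ring
  have hD0 : D 0 = listMinor (j + 1) X l (0 :: List.range' (t + 1) (j + 1 - 1)) := by
    unfold listMinor
    simp only [hD]
    congr 1
    ext i b
    refine Fin.cases ?_ (fun b => ?_) b
    · simp
    · simp only [Matrix.of_apply, Fin.cons_succ, Fin.zero_succAbove, Fin.val_succ,
        List.getD_cons_succ]
      rw [getD_range' _ _ _ (by omega), add_assoc, add_comm 1]
  have hcont : Continuous fun ε : ℝ =>
      ∑ b : Fin (j + 1), (-1) ^ (b : ℕ) * ε ^ (b : ℕ) * (σ * D b) := by fun_prop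
  have hz : ∑ b : Fin (j + 1), (-1) ^ (b : ℕ) * (0 : ℝ) ^ (b : ℕ) * (σ * D b) = σ * D 0 := by
    rw [Fin.sum_univ_succ]
    simp
  have hev : ∀ᶠ ε in nhds (0 : ℝ),
      0 < ∑ b : Fin (j + 1), (-1) ^ (b : ℕ) * ε ^ (b : ℕ) * (σ * D b) := by
    refine hcont.continuousAt.eventually (lt_mem_nhds ?_)
    exact lt_of_lt_of_eq h1 (by rw [← hD0, ← hz])
  filter_upwards [nhdsWithin_le_nhds hev, self_mem_nhdsWithin] with ε h2 h3
  rw [hexp]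
  exact add_pos_of_nonneg_of_pos h0 (mul_pos (pow_pos h3 t) h2)

/-! ### Variation bounding from prescribed minors -/

/-- The condition `1 ≤ p' ∨ t' = 0` says that the column set contains column `0`. -/
theorem listMinor_pos_of_zero_mem {k n N : ℕ} (hk : 1 ≤ k) (hkn : k ≤ n) (hkN : k ≤ N)
    (X : ℕ → ℕ → ℝ) (σ : ℝ)
    (hpos : ∀ p t p' t', p < k → k + t ≤ N → p' < k → k + t' ≤ n → 1 ≤ p' ∨ t' = 0 →
      0 < σ * listMinor k X (List.range p ++ List.range' (p + t) (k - p))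
        (List.range p' ++ List.range' (p' + t') (k - p')))
    (l : List ℕ) (hl : l.Pairwise (· < ·)) (hlen : l.length = k) (hmem : ∀ x ∈ l, x < N)
    (m : List ℕ) (hm : m.Pairwise (· < ·)) (hmlen : m.length = k - 1)
    (hmmem : ∀ x ∈ m, 1 ≤ x ∧ x < n) :
    0 < σ * listMinor k X l (0 :: m) := by
  have := listMinor_pos_of_cols hk X σ n hkn l 1 hk ?_ m hm hmlen hmmem
  · simpa [List.range_succ] using this
  · intro p' t' hp' hpt ht'
    exact listMinor_pos_of_rows hk X σ N hkN _
      (fun p t hp ht => hpos p t p' t' hp ht hp' ht' hpt) l hl hlen hmem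

theorem eventually_listMinor_pos {k n N : ℕ} (hk : 1 ≤ k) (hkn : k ≤ n) (hkN : k ≤ N)
    (X : ℕ → ℕ → ℝ) (σ : ℝ)
    (hpos : ∀ p t p' t', p < k → k + t ≤ N → p' < k → k + t' ≤ n → 1 ≤ p' ∨ t' = 0 →
      0 < σ * listMinor k X (List.range p ++ List.range' (p + t) (k - p))
        (List.range p' ++ List.range' (p' + t') (k - p')))
    (hnonneg : ∀ p t t', p < k → k + t ≤ N → k + t' ≤ n →
      0 ≤ σ * listMinor k X (List.range p ++ List.range' (p + t) (k - p)) (List.range' t' k)) :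
    ∀ᶠ ε in nhdsWithin (0 : ℝ) (Set.Ioi 0), ∀ l m : List ℕ,
      l.Pairwise (· < ·) → l.length = k → (∀ x ∈ l, x < N) →
      m.Pairwise (· < ·) → m.length = k → (∀ x ∈ m, x < n) →
      0 < σ * listMinor k (addFirstColumn X ε) l m := by
  have hzero := listMinor_pos_of_zero_mem hk hkn hkN X σ hpos
  have hrows : ∀ p t, p < k → k + t ≤ N →
      (List.range p ++ List.range' (p + t) (k - p)).Pairwise (· < ·) ∧
      (List.range p ++ List.range' (p + t) (k - p)).length = k ∧
      ∀ x ∈ List.range p ++ List.range' (p + t) (k - p), x < N := by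
    intro p t hp ht
    refine ⟨?_, by simp; omega, ?_⟩
    · refine List.pairwise_append.2 ⟨List.pairwise_lt_range, List.pairwise_lt_range', ?_⟩
      intro a ha b hb
      rw [List.mem_range] at ha
      rw [List.mem_range'_1] at hb
      omega
    · intro x hx
      rw [List.mem_append, List.mem_range, List.mem_range'_1] at hx
      omega
  have hev : ∀ᶠ ε in nhdsWithin (0 : ℝ) (Set.Ioi 0), ∀ p ∈ Finset.range k,
      ∀ t ∈ Finset.range (N + 1), ∀ t' ∈ Finset.range (n + 1), k + t ≤ N → k + t' ≤ n → 1 ≤ t' →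
      0 < σ * listMinor k (addFirstColumn X ε) (List.range p ++ List.range' (p + t) (k - p))
        (List.range' t' k) := by
    refine (Filter.eventually_all_finset _).2 fun p hp => ?_
    refine (Filter.eventually_all_finset _).2 fun t _ => ?_
    refine (Filter.eventually_all_finset _).2 fun t' _ => ?_
    rw [Finset.mem_range] at hp
    by_cases h : k + t ≤ N ∧ k + t' ≤ n ∧ 1 ≤ t'
    · obtain ⟨ht, ht', h1⟩ := h
      obtain ⟨r1, r2, r3⟩ := hrows p t hp ht
      filter_upwards [eventually_listMinor_addFirstColumn_pos hk X σ _ t' h1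
        (hnonneg p t t' hp ht ht') (hzero _ r1 r2 r3 _ List.pairwise_lt_range' (by simp)
          (fun x hx => by rw [List.mem_range'_1] at hx; omega))] with ε hε
      exact fun _ _ _ => hε
    · exact Filter.Eventually.of_forall fun ε h1 h2 h3 => absurd ⟨h1, h2, h3⟩ h
  filter_upwards [hev] with ε hε l m hl hlen hmem hm hmlen hmmem
  have := listMinor_pos_of_cols hk (addFirstColumn X ε) σ n hkn l 0 (Nat.zero_le _) ?_ m hm
    (by simpa using hmlen) (fun x hx => ⟨Nat.zero_le _, hmmem x hx⟩)
  · simpa using this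
  intro p' t' hp' _ ht'
  refine listMinor_pos_of_rows hk _ σ N hkN _ (fun p t hp ht => ?_) l hl hlen hmem
  obtain ⟨r1, r2, r3⟩ := hrows p t hp ht
  by_cases hz : 1 ≤ p' ∨ t' = 0
  · have h1 := hpos p t p' t' hp ht hp' ht' hz
    have h2 : ∃ m', List.range p' ++ List.range' (p' + t') (k - p') = 0 :: m' := by
      rcases Nat.eq_zero_or_pos p' with rfl | hp0
      · obtain rfl : t' = 0 := by omega
        obtain ⟨j, rfl⟩ : ∃ j, k = j + 1 := ⟨k - 1, by omega⟩
        exact ⟨_, by simp [List.range'_succ]; rfl⟩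
      · obtain ⟨j, rfl⟩ : ∃ j, p' = j + 1 := ⟨p' - 1, by omega⟩
        exact ⟨_, by rw [List.range_succ_eq_map, List.cons_append]⟩
    obtain ⟨m', hm'⟩ := h2
    rw [hm'] at h1 ⊢
    rwa [listMinor_addFirstColumn_of_head]
  · obtain rfl : p' = 0 := by omega
    have := hε p (by simpa using hp) t (by simp; omega) t' (by simp; omega) ht ht' (by omega)
    simpa using this

theorem encard_signChanges_lt_of_minors {k n : ℕ} (hk : 1 ≤ k) (hkn : k ≤ n)
    (X : ℕ → ℕ → ℝ) (σ : ℝ)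
    (hpos : ∀ p t p' t', p < k → p' < k → k + t' ≤ n → 1 ≤ p' ∨ t' = 0 →
      0 < σ * listMinor k X (List.range p ++ List.range' (p + t) (k - p))
        (List.range p' ++ List.range' (p' + t') (k - p')))
    (hnonneg : ∀ p t t', p < k → k + t' ≤ n →
      0 ≤ σ * listMinor k X (List.range p ++ List.range' (p + t) (k - p)) (List.range' t' k))
    (u : Fin n → ℝ) (hu : (signChanges u).encard < k) :
    (signChanges fun s : ℕ => ∑ j : Fin n, u j * X s j).encard < k := by
  by_contra! hle
  obtain ⟨s, hs, halt⟩ := exists_alternating_of_le_encard _ hk hle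
  -- Only rows up to the last sample matter, so finitely many minors constrain `ε`.
  set N := s (Fin.last k) + 1 with hN
  have hsN : ∀ i, s i < N := fun i => Nat.lt_succ_of_le (hs.monotone (Fin.le_last i))
  have hsle : ∀ i : Fin (k + 1), (i : ℕ) ≤ s i := by
    intro i
    induction i using Fin.induction with
    | zero => simp
    | succ i ih =>
      have := hs (Fin.castSucc_lt_succ (i := i))
      simp only [Fin.val_castSucc, Fin.val_succ] at ih ⊢
      omega
  have hkN : k ≤ N := (hsle (Fin.last k)).trans (Nat.le_succ _)
  have hev := eventually_listMinor_pos hk hkn hkN X σ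
    (fun p t p' t' hp _ hp' ht' h => hpos p t p' t' hp hp' ht' h)
    (fun p t t' hp _ ht' => hnonneg p t t' hp ht')
  have hcont : ∀ i, Continuous fun ε => ∑ j : Fin n, u j * addFirstColumn X ε (s i) j :=
    fun i => continuous_finsetSum _ fun j _ =>
      continuous_const.mul (continuous_addFirstColumn X _ _)
  have hev2 : ∀ᶠ ε in nhdsWithin (0 : ℝ) (Set.Ioi 0), ∀ i : Fin k,
      (∑ j : Fin n, u j * addFirstColumn X ε (s i.castSucc) j) *
        (∑ j : Fin n, u j * addFirstColumn X ε (s i.succ) j) < 0 := by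
    -- Strict alternation at the samples is an open condition in `ε` and holds at `ε = 0`.
    refine nhdsWithin_le_nhds (Filter.eventually_all.2 fun i => ?_)
    refine ((hcont i.castSucc).mul (hcont i.succ)).continuousAt.eventually (gt_mem_nhds ?_)
    simpa only [Pi.mul_apply, addFirstColumn_zero] using halt i
  obtain ⟨ε, hmin, halt'⟩ := (hev.and hev2).exists
  set f : Fin n → Fin (k + 1) → ℝ := fun j i => addFirstColumn X ε (s i) j with hf
  refine sum_smul_not_alternating hk σ ((List.finRange n).map fun j => (f j, u j)) (by simpa)
    ?_ ?_ ?_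
  · intro i m hm hml
    rw [List.map_map, List.sublist_map_iff] at hm
    obtain ⟨m', hm', rfl⟩ := hm
    have hm'p : m'.Pairwise (· < ·) := (List.pairwise_lt_finRange n).sublist hm'
    have := hmin (List.ofFn fun a => s (i.succAbove a)) (m'.map Fin.val) ?_ (by simp) ?_ ?_
      (by simpa using hml) ?_
    · rw [listMinor_eq_cols _ _ _ (by simpa using hml)] at this
      convert this using 3
      rw [List.map_map, List.map_map]
      refine List.map_congr_left fun j _ => ?_
      funext a
      simp [hf]
    · rw [List.pairwise_ofFn]
      exact fun a b hab => hs ((Fin.strictMono_succAbove i) hab)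
    · intro x hx
      obtain ⟨a, rfl⟩ := (List.mem_ofFn' _ _).1 hx
      exact hsN _
    · exact List.pairwise_map.2 hm'p
    · intro x hx
      obtain ⟨j, -, rfl⟩ := List.mem_map.1 hx
      exact j.2
  · intro m hm hml hch
    rw [List.map_map, List.sublist_map_iff] at hm
    obtain ⟨m', hm', rfl⟩ := hm
    have hm'p : m'.Pairwise (· < ·) := (List.pairwise_lt_finRange n).sublist hm'
    rw [List.isChain_map] at hch
    rcases m' with _ | ⟨a, m'⟩
    · simp at hml
    have h1 := (length_le_encard_signChanges u a m' hm'p hch).trans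
      (Set.encard_le_encard (Set.sep_subset _ _))
    have h2 : m'.length = k := by simpa using hml
    rw [h2] at h1
    exact absurd hu (not_lt.2 h1)
  · have e : ∀ i, ((((List.finRange n).map fun j => (f j, u j)).map fun q : (Fin (k + 1) → ℝ) × ℝ => q.2 • q.1).sum) i
        = ∑ j : Fin n, u j * addFirstColumn X ε (s i) j := by
      intro i
      rw [List.map_map, ← List.ofFn_eq_map, List.sum_ofFn, Finset.sum_apply]
      rfl
    intro i
    rw [e, e]
    exact halt' i

/-! ### The Cauchy–Binet formula and compound matrices -/

theorem det_mul_eq_sum_functions {m r : ℕ} (A : Matrix (Fin r) (Fin m) ℝ)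
    (B : Matrix (Fin m) (Fin r) ℝ) :
    (A * B).det = ∑ f : Fin r → Fin m, (∏ i, A i (f i)) * (B.submatrix f id).det := by
  have h : A * B = Matrix.of fun i => ∑ j, A i j • B j := by
    ext i j
    simp [Matrix.mul_apply, Finset.sum_apply]
  have h2 := (Matrix.detRowAlternating (n := Fin r) (R := ℝ)).toMultilinearMap.map_sum
    (fun i j => A i j • B j)
  rw [h]
  refine h2.trans (Finset.sum_congr rfl fun f _ => ?_)
  have h3 := (Matrix.detRowAlternating (n := Fin r) (R := ℝ)).toMultilinearMap.map_smul_univ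
    (fun i => A i (f i)) (fun i => B (f i))
  exact h3

/-- An injective index function is uniquely an increasing tuple composed with a permutation; a
non-injective one repeats a row of `B`. -/
theorem det_mul_eq_sum_increasingTuples {m r : ℕ} (A : Matrix (Fin r) (Fin m) ℝ)
    (B : Matrix (Fin m) (Fin r) ℝ) :
    (A * B).det = ∑ v ∈ increasingTuples m r,
      (A.submatrix id (ofLex v)).det * (B.submatrix (ofLex v) id).det := by
  classical
  have h1 : ∀ v ∈ increasingTuples m r,
      (A.submatrix id (ofLex v)).det * (B.submatrix (ofLex v) id).det =
        ∑ s : Equiv.Perm (Fin r), (∏ i, A i (ofLex v (s i))) *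
          (B.submatrix (ofLex v ∘ s) id).det := by
    intro v _
    rw [← Matrix.det_transpose (A.submatrix id (ofLex v)), Matrix.det_apply', Finset.sum_mul]
    refine Finset.sum_congr rfl fun s _ => ?_
    have h2 : (B.submatrix (ofLex v ∘ s) id).det
        = (Equiv.Perm.sign s : ℝ) * (B.submatrix (ofLex v) id).det := by
      rw [← Matrix.det_permute]
      rfl
    rw [h2]
    simp only [Matrix.transpose_apply, Matrix.submatrix_apply, id]
    ring
  rw [Finset.sum_congr rfl h1, det_mul_eq_sum_functions, ← Finset.sum_product']
  symm
  refine Finset.sum_of_injOn (fun p => ofLex p.1 ∘ p.2) ?_ (fun _ _ => Finset.mem_coe.2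
    (Finset.mem_univ _)) ?_ (fun _ _ => rfl)
  · rintro ⟨v, s⟩ hv ⟨w, t⟩ hw h
    simp only [Finset.coe_product, Set.mem_prod, Finset.mem_coe, mem_increasingTuples] at hv hw h
    have h2 : Set.range (ofLex v) = Set.range (ofLex w) := by
      rw [← s.surjective.range_comp, ← t.surjective.range_comp (ofLex w), h]
    have h3 : v = w := ofLex.injective ((StrictMono.range_inj hv.1 hw.1).1 h2)
    subst h3
    refine Prod.ext rfl (Equiv.ext fun i => hv.1.injective (congrFun h i))
  · intro f _ hf
    have hinj : ¬ Function.Injective f := by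
      intro hinj
      refine hf ⟨(toLex (f ∘ Tuple.sort f), (Tuple.sort f)⁻¹), ?_, ?_⟩
      · simp only [Finset.coe_product, Set.mem_prod, Finset.mem_coe, mem_increasingTuples]
        exact ⟨(Tuple.monotone_sort f).strictMono_of_injective
          (hinj.comp (Tuple.sort f).injective), Finset.mem_univ _⟩
      · funext i
        simp
    rw [Function.not_injective_iff] at hinj
    obtain ⟨a, b, hab, hne⟩ := hinj
    rw [Matrix.det_zero_of_row_eq hne (by funext j; simp [hab]), mul_zero]

theorem strictMono_lexTuple (n r : ℕ) (i : Fin (n.choose r)) : StrictMono (lexTuple n r i) :=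
  (mem_increasingTuples _).1 (Finset.orderEmbOfFin_mem _ _ _)

theorem det_mul_eq_sum_lexTuple {m r : ℕ} (A : Matrix (Fin r) (Fin m) ℝ)
    (B : Matrix (Fin m) (Fin r) ℝ) :
    (A * B).det = ∑ i : Fin (m.choose r),
      (A.submatrix id (lexTuple m r i)).det * (B.submatrix (lexTuple m r i) id).det := by
  rw [det_mul_eq_sum_increasingTuples, ← Finset.sum_coe_sort,
    ← Equiv.sum_comp ((increasingTuples m r).orderIsoOfFin (card_increasingTuples m r)).toEquiv]
  rfl

theorem compound_mul {l m n : ℕ} (X : Matrix (Fin l) (Fin m) ℝ) (Y : Matrix (Fin m) (Fin n) ℝ)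
    (r : ℕ) : compound (X * Y) r = compound X r * compound Y r := by
  ext i j
  rw [Matrix.mul_apply]
  have h : (X * Y).submatrix (lexTuple l r i) (lexTuple n r j) =
      X.submatrix (lexTuple l r i) id * Y.submatrix id (lexTuple n r j) := by
    ext a b
    simp [Matrix.mul_apply]
  simp only [compound, Matrix.of_apply]
  rw [h, det_mul_eq_sum_lexTuple]
  rfl

theorem compound_pow_mul {m n : ℕ} (X : Matrix (Fin m) (Fin m) ℝ) (Y : Matrix (Fin m) (Fin n) ℝ)
    (r t : ℕ) : compound X r ^ t * compound Y r = compound (X ^ t * Y) r := by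
  induction t generalizing Y with
  | zero => simp
  | succ t ih =>
    rw [pow_succ, Matrix.mul_assoc, ← compound_mul, ih, pow_succ, Matrix.mul_assoc]

theorem lexTuple_onlyIndex (r : ℕ) : lexTuple r r (onlyIndex r) = id := by
  have h := strictMono_lexTuple r r (onlyIndex r)
  refine (StrictMono.range_inj h strictMono_id).1 ?_
  rw [(Finite.injective_iff_surjective.1 h.injective).range_eq, Set.range_id]

/-! ### The increasing tuples that start with an initial segment -/

theorem Fin.val_le_of_strictMono {k n : ℕ} (w : Fin k → Fin n) (hw : StrictMono w) (i : Fin k) :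
    (i : ℕ) ≤ w i := by
  obtain ⟨i, hi⟩ := i
  induction i with
  | zero => simp
  | succ i ih =>
    have h1 := ih (by omega)
    have h2 : w ⟨i, by omega⟩ < w ⟨i + 1, hi⟩ := hw (Fin.mk_lt_mk.2 (by omega))
    rw [Fin.lt_def] at h2
    simp only at h1 ⊢
    omega

theorem Fin.val_eq_of_strictMono_of_isLowerSet {a b : ℕ} (f : Fin a → Fin b) (hf : StrictMono f)
    (hr : IsLowerSet (Set.range f)) (i : Fin a) : (f i : ℕ) = i := by
  obtain ⟨i, hi⟩ := i
  induction i using Nat.strong_induction_on with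
  | _ i ih =>
    have h1 : i ≤ f ⟨i, hi⟩ := Fin.val_le_of_strictMono f hf ⟨i, hi⟩
    refine le_antisymm ?_ h1
    by_contra! h2
    simp only at h2
    obtain ⟨j, hj⟩ := hr (a := f ⟨i, hi⟩) (b := ⟨i, h2.trans (f ⟨i, hi⟩).2⟩)
      (Fin.le_def.2 h2.le) ⟨_, rfl⟩
    have h3 : (f j : ℕ) = i := by rw [hj]
    have h4 : j < ⟨i, hi⟩ := hf.lt_iff_lt.1 (Fin.lt_def.2 (by omega))
    have h5 : (j : ℕ) < i := h4
    have h6 := ih j h5 j.2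
    simp only [Fin.eta] at h6
    omega

/-- Put the segment `0, …, p - 1` in front of a tuple shifted by `p`. -/
def prependSegment {q r : ℕ} (p n k : ℕ) (hn : p + q = n) (hk : p + r = k) (v : Fin r → Fin q)
    (i : Fin k) : Fin n :=
  if h : (i : ℕ) < p then ⟨i, by omega⟩ else ⟨p + v ⟨i - p, by omega⟩, by omega⟩

theorem strictMono_prependSegment {q r : ℕ} (p n k : ℕ) (hn : p + q = n) (hk : p + r = k)
    (v : Fin r → Fin q) (hv : StrictMono v) : StrictMono (prependSegment p n k hn hk v) := by
  intro i j hij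
  have hij' : (i : ℕ) < j := hij
  rw [Fin.lt_def]
  unfold prependSegment
  split_ifs with h1 h2 h2
  · exact hij'
  · simp only
    omega
  · omega
  · have := hv (a := ⟨i - p, by omega⟩) (b := ⟨j - p, by omega⟩) (Fin.mk_lt_mk.2 (by omega))
    simpa using this

theorem exists_prependSegment {q r : ℕ} (p n k : ℕ) (hn : p + q = n) (hk : p + r = k)
    (w : Fin k → Fin n) (hw : StrictMono w) (h : ∀ i : Fin k, (i : ℕ) < p → (w i : ℕ) = i) :
    ∃ v : Fin r → Fin q, StrictMono v ∧ prependSegment p n k hn hk v = w := by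
  have hge := Fin.val_le_of_strictMono w hw
  have hp : ∀ i : Fin r, p ≤ w ⟨p + i, by omega⟩ := fun i =>
    (Nat.le_add_right p i).trans (hge ⟨p + i, by omega⟩)
  refine ⟨fun i => ⟨w ⟨p + i, by omega⟩ - p, by have := hp i; omega⟩, ?_, ?_⟩
  · intro i j hij
    have h2 : w ⟨p + i, by omega⟩ < w ⟨p + j, by omega⟩ :=
      hw (Fin.mk_lt_mk.2 (Nat.add_lt_add_left hij p))
    have h3 : (w ⟨p + i, by omega⟩ : ℕ) < w ⟨p + j, by omega⟩ := h2
    have := hp i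
    rw [Fin.lt_def]
    simp only
    omega
  · funext i
    unfold prependSegment
    split_ifs with hi
    · exact Fin.ext (h i hi).symm
    · refine Fin.ext ?_
      have h1 := hge i
      have h2 : (⟨p + (i - p), by omega⟩ : Fin k) = i := Fin.ext (by simp; omega)
      simp only [h2]
      omega

theorem prependSegment_lt {q r : ℕ} (p n k : ℕ) (hn : p + q = n) (hk : p + r = k)
    (v v' : Fin r → Fin q) (h : toLex v < toLex v') :
    toLex (prependSegment p n k hn hk v) < toLex (prependSegment p n k hn hk v') := by
  obtain ⟨i, hi, hlt⟩ := h
  refine ⟨⟨p + i, by omega⟩, fun j hj => ?_, ?_⟩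
  · have hj' : (j : ℕ) < p + i := hj
    change prependSegment p n k hn hk v j = prependSegment p n k hn hk v' j
    unfold prependSegment
    split_ifs with h1
    · rfl
    · refine Fin.ext ?_
      have h2 : v ⟨j - p, by omega⟩ = v' ⟨j - p, by omega⟩ :=
        hi ⟨j - p, by omega⟩ (Fin.lt_def.2 (by simp only; omega))
      simp only [h2]
  · change prependSegment p n k hn hk v _ < prependSegment p n k hn hk v' _
    have h2 : (v i : ℕ) < v' i := hlt
    rw [Fin.lt_def]
    simpa [prependSegment] using h2

/-- Increasing tuples satisfy `i ≤ w i`, so a first deviation from `0, …, p - 1` makes a tuple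
lexicographically larger. The tuples starting with this segment thus form a lower set, and `f`
preserves numerical positions. -/
theorem lexTuple_initial {q r : ℕ} (p n k : ℕ) (hn : p + q = n) (hk : p + r = k)  :
    ∃ f : Fin (q.choose r) → Fin (n.choose k), Function.Injective f ∧ (∀ i, (f i : ℕ) = i) ∧
      (∀ i, lexTuple n k (f i) = prependSegment p n k hn hk (lexTuple q r i)) ∧
      ∀ j, j ∉ Set.range f → ∃ i : Fin k, (i : ℕ) < p ∧ (lexTuple n k j i : ℕ) ≠ i := by
  set e := (increasingTuples n k).orderIsoOfFin (card_increasingTuples n k) with he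
  set f : Fin (q.choose r) → Fin (n.choose k) := fun i =>
    e.symm ⟨toLex (prependSegment p n k hn hk (lexTuple q r i)), (mem_increasingTuples _).2
      (strictMono_prependSegment p n k hn hk _ (strictMono_lexTuple q r i))⟩ with hf
  have hlex : ∀ i, lexTuple n k (f i) = prependSegment p n k hn hk (lexTuple q r i) := by
    intro i
    change ofLex ((e (f i) : Lex (Fin k → Fin n))) = _
    simp [hf]
  have hmono : StrictMono f := by
    intro i j hij
    refine e.symm.strictMono (Subtype.mk_lt_mk.2 (prependSegment_lt p n k hn hk _ _ ?_))
    exact (Finset.orderEmbOfFin _ (card_increasingTuples q r)).strictMono hij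
  have hrange : ∀ j, (∀ i : Fin k, (i : ℕ) < p → (lexTuple n k j i : ℕ) = i) →
      j ∈ Set.range f := by
    intro j hj
    obtain ⟨v, hv, hvw⟩ := exists_prependSegment p n k hn hk _ (strictMono_lexTuple n k j) hj
    set i := ((increasingTuples q r).orderIsoOfFin (card_increasingTuples q r)).symm
      ⟨toLex v, (mem_increasingTuples _).2 hv⟩ with hi
    have hiv : lexTuple q r i = v := by
      change ofLex ((((increasingTuples q r).orderIsoOfFin (card_increasingTuples q r)) i :
        Lex (Fin r → Fin q))) = _
      simp [hi]
    refine ⟨i, ?_⟩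
    refine (increasingTuples n k).orderEmbOfFin (card_increasingTuples n k) |>.injective ?_
    refine ofLex.injective ?_
    change lexTuple n k (f i) = lexTuple n k j
    rw [hlex, hiv, hvw]
  have hlower : IsLowerSet (Set.range f) := by
    rintro _ j hj ⟨i₀, rfl⟩
    refine hrange j ?_
    intro i
    obtain ⟨i, hi⟩ := i
    induction i using Nat.strong_induction_on with
    | _ i ih =>
      intro hip
      by_contra hne
      have h1 := Fin.val_le_of_strictMono _ (strictMono_lexTuple n k j) ⟨i, hi⟩
      have h2 : toLex (lexTuple n k (f i₀)) < toLex (lexTuple n k j) := by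
        rw [hlex]
        refine ⟨⟨i, hi⟩, fun a ha => ?_, ?_⟩
        · have ha' : (a : ℕ) < i := ha
          refine Fin.ext ?_
          have := ih a ha' a.2 (by simp only; omega)
          simp only [Fin.eta] at this
          change (prependSegment p n k hn hk _ a : ℕ) = lexTuple n k j a
          rw [this]
          simp [prependSegment, show (a : ℕ) < p by omega]
        · change prependSegment p n k hn hk _ _ < lexTuple n k j _
          have hip' : i < p := hip
          rw [Fin.lt_def]
          simp only [prependSegment, hip', dif_pos]
          simp only at h1 hne
          omega
      have h3 : f i₀ < j := ((increasingTuples n k).orderEmbOfFin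
        (card_increasingTuples n k)).lt_iff_lt.1 h2
      exact absurd hj (not_le.2 h3)
  refine ⟨f, hmono.injective, Fin.val_eq_of_strictMono_of_isLowerSet f hmono hlower, hlex,
    fun j hj => ?_⟩
  by_contra! hcon
  exact hj (hrange j hcon)

/-! ### Minors of observability matrices as impulse responses -/

theorem pow_mem_span_pow {n : ℕ} (A : Matrix (Fin n) (Fin n) ℝ) (hn : 1 ≤ n) (t : ℕ) :
    ∃ a : ℕ → ℝ, A ^ t = ∑ i ∈ Finset.range n, a i • A ^ i := by
  have : Nonempty (Fin n) := ⟨⟨0, hn⟩⟩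
  refine ⟨fun i => ((Polynomial.X ^ t : Polynomial ℝ) %ₘ A.charpoly).coeff i, ?_⟩
  rw [Matrix.pow_eq_aeval_mod_charpoly]
  refine Polynomial.aeval_eq_sum_range' ?_ _
  have h1 : A.charpoly.natDegree = n := by
    rw [Matrix.charpoly_natDegree_eq_dim, Fintype.card_fin]
  have h2 := Polynomial.natDegree_modByMonic_lt (Polynomial.X ^ t : Polynomial ℝ)
    (Matrix.charpoly_monic A) (by
      intro h
      rw [h, Polynomial.natDegree_one] at h1
      omega)
  omega

/-- By Cayley–Hamilton, a vector killed by the first `n` output rows is killed by all of them. -/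
theorem isUnit_det_obsMatrix {n : ℕ} (A : Matrix (Fin n) (Fin n) ℝ) (c : Fin n → ℝ)
    (hn : 1 ≤ n) (hobs : IsObservable A c) : IsUnit (obsMatrix A c n).det := by
  rw [isUnit_iff_ne_zero]
  intro h0
  obtain ⟨v, hv, hv0⟩ := Matrix.exists_mulVec_eq_zero_iff.2 h0
  refine hv (hobs ?_)
  rw [map_zero]
  have h1 : ∀ i < n, c ⬝ᵥ ((A ^ i) *ᵥ v) = 0 := by
    intro i hi
    rw [Matrix.dotProduct_mulVec]
    exact congrFun hv0 ⟨i, hi⟩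
  funext t
  change c ⬝ᵥ ((A ^ t) *ᵥ v) = 0
  obtain ⟨a, ha⟩ := pow_mem_span_pow A hn t
  rw [ha, Matrix.sum_mulVec, dotProduct_sum]
  refine Finset.sum_eq_zero fun i hi => ?_
  rw [Matrix.smul_mulVec, dotProduct_smul, h1 i (Finset.mem_range.1 hi), smul_zero]

theorem impulseResponse_eq_sum {n k : ℕ} (A : Matrix (Fin n) (Fin n) ℝ) (c : Fin n → ℝ)
    (p q r : ℕ) (hn : p + q = n) (hk : p + r = k) (hrq : r ≤ q) (β : Fin k → Fin n)
    (t : ℕ) :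
    impulseResponse (systemA A r) (systemB A c r β) (systemC A c r) t =
      ∑ j : Fin (q.choose r),
        ((obsMatrix A c r * (A ^ (t - 1) * (A ^ p * (obsMatrix A c n)⁻¹ *
          zeroOverIdentity n q))).submatrix id (lexTuple q r j)).det *
        ((obsMatrix A c n * columnSelector β).submatrix
          (prependSegment p n k hn hk (lexTuple q r j)) id).det := by
  obtain rfl : q = n - k + r := by omega
  obtain rfl : p = k - r := by omega
  obtain ⟨f, hinj, hval, hlex, -⟩ := lexTuple_initial (k - r) n k hn hk
  set Y := A ^ (k - r) * (obsMatrix A c n)⁻¹ * zeroOverIdentity n (n - k + r) with hY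
  set W := compound (obsMatrix A c n * columnSelector β) k with hW
  have h1 : impulseResponse (systemA A r) (systemB A c r β) (systemC A c r) t =
      (compound (obsMatrix A c r) r * (compound A r ^ (t - 1) *
        (padZeroColumns (compound Y r) (n.choose k) * W))) (onlyIndex r) (onlyIndex k) := rfl
  rw [h1, ← Matrix.mul_assoc, ← Matrix.mul_assoc, Matrix.mul_apply]
  symm
  refine Finset.sum_of_injOn f hinj.injOn (fun _ _ => Finset.mem_coe.2 (Finset.mem_univ _))
    ?_ ?_
  · intro j _ hj
    have h2 : ¬ (j : ℕ) < (n - k + r).choose r := fun h =>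
      hj ⟨⟨j, h⟩, by simp, Fin.ext (hval ⟨j, h⟩)⟩
    rw [Matrix.mul_apply, Finset.sum_eq_zero, zero_mul]
    intro i _
    simp [padZeroColumns, h2]
  · intro j _
    have h2 : (compound (obsMatrix A c r) r * compound A r ^ (t - 1) *
        padZeroColumns (compound Y r) (n.choose k)) (onlyIndex r) (f j) =
        (compound (obsMatrix A c r) r * compound A r ^ (t - 1) * compound Y r)
          (onlyIndex r) j := by
      rw [Matrix.mul_apply, Matrix.mul_apply]
      refine Finset.sum_congr rfl fun i _ => ?_
      have h3 : (f j : ℕ) < (n - k + r).choose r := by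
        rw [hval]
        exact j.2
      have h4 : (⟨f j, h3⟩ : Fin ((n - k + r).choose r)) = j := Fin.ext (hval j)
      simp only [padZeroColumns, Matrix.of_apply, h3, dif_pos, h4]
    rw [h2, Matrix.mul_assoc, compound_pow_mul, ← compound_mul]
    simp only [compound, Matrix.of_apply, hW, lexTuple_onlyIndex, hlex]

theorem det_eq_of_identity_rows {p r k : ℕ} (hk : p + r = k) (G : Matrix (Fin k) (Fin k) ℝ)
    (hG : ∀ i j : Fin k, (i : ℕ) < p → G i j = if i = j then 1 else 0) :
    G.det = (Matrix.of fun i j : Fin r =>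
      G ⟨p + i, by omega⟩ ⟨p + j, by omega⟩).det := by
  subst hk
  rw [← Matrix.det_submatrix_equiv_self finSumFinEquiv]
  have h : G.submatrix finSumFinEquiv finSumFinEquiv = Matrix.fromBlocks 1 0
      (Matrix.of fun i j => G (Fin.natAdd p i) (Fin.castAdd r j))
      (Matrix.of fun i j : Fin r => G ⟨p + i, by omega⟩ ⟨p + j, by omega⟩) := by
    ext i j
    rcases i with i | i <;> rcases j with j | j
    · simp [hG (Fin.castAdd r i) _ i.2, Matrix.one_apply]
    · simp only [Matrix.submatrix_apply, finSumFinEquiv_apply_left, finSumFinEquiv_apply_right,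
        hG (Fin.castAdd r i) _ i.2, Matrix.fromBlocks_apply₁₂, Matrix.zero_apply]
      rw [if_neg]
      intro h
      have := congrArg Fin.val h
      simp at this
      omega
    · simp
    · simp
      rfl
  rw [h, Matrix.det_fromBlocks_zero₁₂, Matrix.det_one, one_mul]

theorem det_obsMatrix_submatrix {n k N : ℕ} (A : Matrix (Fin n) (Fin n) ℝ) (c : Fin n → ℝ)
    (hu : IsUnit (obsMatrix A c n).det) (p q r : ℕ) (hn : p + q = n) (hk : p + r = k)
    (hrq : r ≤ q) (β : Fin k → Fin n) (t : ℕ) (α : Fin k → Fin N)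
    (hα : ∀ i, (α i : ℕ) = if (i : ℕ) < p then (i : ℕ) else i + (t - 1)) :
    ((obsMatrix A c N).submatrix α β).det =
      impulseResponse (systemA A r) (systemB A c r β) (systemC A c r) t := by
  rw [impulseResponse_eq_sum A c p q r hn hk hrq β t]
  set O := obsMatrix A c n with hO
  set G : Matrix (Fin k) (Fin n) ℝ := (obsMatrix A c N).submatrix α id * O⁻¹ with hG
  have h1 : (obsMatrix A c N).submatrix α β = G * (O * columnSelector β) := by
    rw [hG, Matrix.mul_assoc, ← Matrix.mul_assoc O⁻¹, Matrix.nonsing_inv_mul _ hu,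
      Matrix.one_mul]
    ext i j
    simp [Matrix.mul_apply, columnSelector, Matrix.one_apply]
  rw [h1, det_mul_eq_sum_lexTuple]
  obtain ⟨f, hinj, hval, hlex, hrange⟩ := lexTuple_initial p n k hn hk
  have hGrow : ∀ i : Fin k, ∀ j, (i : ℕ) < p → G i j = if (i : ℕ) = j then 1 else 0 := by
    intro i j hi
    have h2 : G i j = (O * O⁻¹) ⟨i, by omega⟩ j := by
      rw [hG, Matrix.mul_apply, Matrix.mul_apply]
      refine Finset.sum_congr rfl fun l _ => ?_
      simp [hO, obsMatrix, hα, hi]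
    rw [h2, Matrix.mul_nonsing_inv _ hu, Matrix.one_apply]
    simp [Fin.ext_iff]
  symm
  refine Finset.sum_of_injOn f hinj.injOn (fun _ _ => Finset.mem_coe.2 (Finset.mem_univ _))
    ?_ ?_
  · intro j _ hj
    obtain ⟨⟨i, hi⟩, hip, hne⟩ := hrange j (by simpa using hj)
    refine mul_eq_zero_of_left ?_ _
    by_contra hdet
    -- A nonzero determinant forces the tuple to contain each `i < p`, as otherwise the unit row `i`
    -- restricts to zero. An increasing tuple containing them all must start with them.
    have hmem : ∀ i : Fin k, (i : ℕ) < p → ∃ a, (i : ℕ) = lexTuple n k j a := by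
      intro i hip
      by_contra! h
      refine hdet (Matrix.det_eq_zero_of_row_eq_zero i fun a => ?_)
      rw [Matrix.submatrix_apply, id, hGrow i _ hip, if_neg (h a)]
    refine hne ?_
    clear hne
    induction i using Nat.strong_induction_on with
    | _ i ih =>
      obtain ⟨a, ha⟩ := hmem ⟨i, hi⟩ hip
      have h3 := Fin.val_le_of_strictMono _ (strictMono_lexTuple n k j) a
      simp only at ha hip
      rcases (show (a : ℕ) ≤ i by omega).lt_or_eq with h4 | h4
      · have := ih a h4 a.2 (by simp only; omega)
        simp only [Fin.eta] at this
        omega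
      · have h5 : a = ⟨i, hi⟩ := Fin.ext h4
        rw [← h5]
        exact (ha.symm.trans h4.symm)
  · intro j _
    rw [hlex]
    congr 1
    rw [det_eq_of_identity_rows hk (G.submatrix id (prependSegment p n k hn hk (lexTuple q r j)))]
    · congr 1
      ext a b
      simp only [Matrix.submatrix_apply, Matrix.of_apply, id]
      have h3 : ∀ i : Fin q, (prependSegment p n k hn hk (lexTuple q r j) ⟨p + b, by omega⟩)
          = ⟨p + lexTuple q r j b, by omega⟩ := by
        intro i
        simp [prependSegment]
      rw [h3 (lexTuple q r j b), ← Matrix.mul_assoc, ← Matrix.mul_assoc, ← Matrix.mul_assoc,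
        Matrix.mul_apply, Finset.sum_eq_single (⟨p + lexTuple q r j b, by omega⟩)]
      · have h4 : (α ⟨p + a, by omega⟩ : ℕ) = a + (t - 1) + p := by
          rw [hα]
          simp
          omega
        have h5 : (obsMatrix A c N).submatrix α id ⟨p + a, by omega⟩ =
            (obsMatrix A c r * A ^ (t - 1) * A ^ p) a := by
          funext l
          simp only [Matrix.submatrix_apply, id, obsMatrix, Matrix.of_apply, h4]
          rw [pow_add, pow_add, ← Matrix.vecMul_vecMul, ← Matrix.vecMul_vecMul]
          rfl
        have h6 : zeroOverIdentity n q ⟨p + lexTuple q r j b, by omega⟩ (lexTuple q r j b) = 1 := by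
          simp [zeroOverIdentity]
          omega
        rw [h6, mul_one, hG, Matrix.mul_apply, Matrix.mul_apply, h5]
      · intro l _ hl
        rw [zeroOverIdentity, Matrix.of_apply, if_neg, mul_zero]
        intro h
        exact hl (Fin.ext (by simp only; omega))
      · simp
    · intro a b hap
      rw [Matrix.submatrix_apply, id, hGrow _ _ hap]
      refine if_congr ?_ rfl rfl
      unfold prependSegment
      split_ifs with h
      · simp [Fin.ext_iff]
      · simp only [Fin.ext_iff]
        omega

/-! ### Index sets -/

theorem range_segments (k p t : ℕ) (hp : p ≤ k) (ht : 1 ≤ t) :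
    (Set.range fun i : Fin k => (if (i : ℕ) < p then (i : ℕ) else i + (t - 1)) + 1) =
      Set.Icc 1 p ∪ Set.Icc (p + t) (k + t - 1) := by
  ext x
  simp only [Set.mem_range, Set.mem_union, Set.mem_Icc]
  constructor
  · rintro ⟨i, rfl⟩
    split_ifs <;> omega
  · rintro (h | h)
    · exact ⟨⟨x - 1, by omega⟩, by simp only; split_ifs <;> omega⟩
    · exact ⟨⟨x - t, by omega⟩, by simp only; split_ifs <;> omega⟩

theorem val_eq_of_indexSet_eq {k n p t : ℕ} (hp : p ≤ k) (ht : 1 ≤ t) (v : Fin k → Fin n)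
    (hv : StrictMono v)
    (h : indexSet v = Set.Icc 1 p ∪ Set.Icc (p + t) (k + t - 1)) (i : Fin k) :
    (v i : ℕ) = if (i : ℕ) < p then (i : ℕ) else i + (t - 1) := by
  rw [← range_segments k p t hp ht, indexSet] at h
  have h1 : StrictMono fun i : Fin k => (v i : ℕ) + 1 := fun a b hab =>
    Nat.add_lt_add_right (Fin.lt_def.1 (hv hab)) 1
  have h2 : StrictMono fun i : Fin k =>
      (if (i : ℕ) < p then (i : ℕ) else i + (t - 1)) + 1 := by
    intro a b hab
    have : (a : ℕ) < b := hab
    simp only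
    split_ifs <;> omega
  have := congrFun ((StrictMono.range_inj h1 h2).1 h) i
  simpa using this

theorem strictMono_of_val_eq {k n p t : ℕ} (v : Fin k → Fin n)
    (hv : ∀ i, (v i : ℕ) = if (i : ℕ) < p then (i : ℕ) else i + t) : StrictMono v := by
  intro a b hab
  have : (a : ℕ) < b := hab
  rw [Fin.lt_def, hv, hv]
  split_ifs <;> omega

theorem indexSet_eq_of_val_eq {k n p t : ℕ} (hp : p ≤ k) (ht : 1 ≤ t) (v : Fin k → Fin n)
    (hv : ∀ i, (v i : ℕ) = if (i : ℕ) < p then (i : ℕ) else i + (t - 1)) :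
    indexSet v = Set.Icc 1 p ∪ Set.Icc (p + t) (k + t - 1) := by
  rw [← range_segments k p t hp ht, indexSet]
  simp only [hv]

theorem isPrescribed_of_val_eq {k n p t : ℕ} (hp : p < k) (htn : k + t ≤ n) (v : Fin k → Fin n)
    (hv : ∀ i, (v i : ℕ) = if (i : ℕ) < p then (i : ℕ) else i + t) : IsPrescribed v := by
  refine ⟨strictMono_of_val_eq v hv, k - p, p + (t + 1), by omega, by omega, by omega, by omega,
    ?_⟩
  rw [indexSet_eq_of_val_eq hp.le (Nat.le_add_left 1 t) v (by simpa using hv)]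
  congr 2 <;> omega

theorem not_isExceptional_of_val_eq {k n p t : ℕ} (hp : p < k) (v : Fin k → Fin n)
    (hv : ∀ i, (v i : ℕ) = if (i : ℕ) < p then (i : ℕ) else i + t) (h : 1 ≤ p ∨ t = 0) :
    ¬ IsExceptional v := by
  rintro ⟨-, s, hs, -, hset⟩
  have h1 : ((v ⟨0, by omega⟩ : ℕ) + 1) ∈ indexSet v := ⟨_, rfl⟩
  rw [hset, hv, Set.mem_Icc] at h1
  simp only at h1
  split_ifs at h1 <;> omega

theorem getD_segments {k p t i : ℕ} (hp : p < k) (hi : i < k) :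
    (List.range p ++ List.range' (p + t) (k - p)).getD i 0 = if i < p then i else i + t := by
  rw [List.getD_eq_getElem _ _ (by simp; omega)]
  split_ifs with h
  · rw [List.getElem_append_left (by simpa using h), List.getElem_range]
  · rw [List.getElem_append_right (by simpa using h), List.getElem_range', List.length_range]
    omega

/-! ### The proposition: impulse responses and variation bounding -/

theorem mainTheorem9 {n : ℕ} (A : Matrix (Fin n) (Fin n) ℝ) (c : Fin n → ℝ)
    (hobs : IsObservable A c) (k : ℕ) (hk : 1 ≤ k) (hkn : k ≤ n) :
    (∀ r : ℕ, 1 ≤ r → r ≤ k → ∀ β : Fin k → Fin n, StrictMono β →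
      ∀ N : ℕ, 1 ≤ N → ∀ t : ℕ, 1 ≤ t → t + k ≤ N + 1 →
      ∀ α : Fin k → Fin N, StrictMono α →
        indexSet α = Set.Icc 1 (k - r) ∪ Set.Icc (k - r + t) (k + t - 1) →
        ((obsMatrix A c N).submatrix α β).det =
          impulseResponse (systemA A r) (systemB A c r β) (systemC A c r) t) ∧
    (((∀ r : ℕ, 1 ≤ r → r ≤ k → ∀ β : Fin k → Fin n, IsPrescribed β →
        (¬ IsExceptional β →
          StrictlyExternallyPositive (systemA A r) (systemB A c r β) (systemC A c r)) ∧
        (IsExceptional β →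
          ExternallyPositive (systemA A r) (systemB A c r β) (systemC A c r) ∧
          ∀ l : ℕ, 1 ≤ l → l ≤ k →
            impulseResponse (systemA A r) (systemB A c r β) (systemC A c r) l ≠ 0)) ∨
      (∀ r : ℕ, 1 ≤ r → r ≤ k → ∀ β : Fin k → Fin n, IsPrescribed β →
        (¬ IsExceptional β →
          StrictlyExternallyNegative (systemA A r) (systemB A c r β) (systemC A c r)) ∧
        (IsExceptional β →
          ExternallyNegative (systemA A r) (systemB A c r β) (systemC A c r) ∧
          ∀ l : ℕ, 1 ≤ l → l ≤ k →
            impulseResponse (systemA A r) (systemB A c r β) (systemC A c r) l ≠ 0))) →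
      IsVariationBounding (k - 1) (obsOperator A c)) := by
  have hu := isUnit_det_obsMatrix A c (hk.trans hkn) hobs
  have hpart : ∀ r : ℕ, 1 ≤ r → r ≤ k → ∀ β : Fin k → Fin n, StrictMono β →
      ∀ N : ℕ, 1 ≤ N → ∀ t : ℕ, 1 ≤ t → t + k ≤ N + 1 →
      ∀ α : Fin k → Fin N, StrictMono α →
        indexSet α = Set.Icc 1 (k - r) ∪ Set.Icc (k - r + t) (k + t - 1) →
        ((obsMatrix A c N).submatrix α β).det =
          impulseResponse (systemA A r) (systemB A c r β) (systemC A c r) t := by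
    intro r hr hrk β _ N _ t ht _ α hα hset
    exact det_obsMatrix_submatrix A c hu (k - r) (n - k + r) r (by omega) (by omega) (by omega) β t α
      (val_eq_of_indexSet_eq (Nat.sub_le k r) ht α hα hset)
  refine ⟨hpart, fun h => ?_⟩
  -- The factor `σ = ±1` treats the positive and negative alternatives together.
  obtain ⟨σ, hσ⟩ : ∃ σ : ℝ, ∀ r : ℕ, 1 ≤ r → r ≤ k → ∀ β : Fin k → Fin n, IsPrescribed β →
      ∀ t, 1 ≤ t →
        (¬ IsExceptional β →
          0 < σ * impulseResponse (systemA A r) (systemB A c r β) (systemC A c r) t) ∧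
        0 ≤ σ * impulseResponse (systemA A r) (systemB A c r β) (systemC A c r) t := by
    rcases h with h | h
    · refine ⟨1, fun r hr hrk β hβ t ht => ?_⟩
      simp only [one_mul]
      obtain ⟨h1, h2⟩ := h r hr hrk β hβ
      refine ⟨fun he => h1 he t ht, ?_⟩
      by_cases he : IsExceptional β
      · exact (h2 he).1 t ht
      · exact (h1 he t ht).le
    · refine ⟨-1, fun r hr hrk β hβ t ht => ?_⟩
      simp only [neg_one_mul, Left.neg_pos_iff, Left.nonneg_neg_iff]
      obtain ⟨h1, h2⟩ := h r hr hrk β hβ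
      refine ⟨fun he => h1 he t ht, ?_⟩
      by_cases he : IsExceptional β
      · exact (h2 he).1 t ht
      · exact (h1 he t ht).le
  set X : ℕ → ℕ → ℝ := fun s j => if h : j < n then (c ᵥ* (A ^ s)) ⟨j, h⟩ else 0 with hX
  have hminor : ∀ p t p' t', p < k → p' < k → k + t' ≤ n → ∃ β : Fin k → Fin n,
      (∀ i, (β i : ℕ) = if (i : ℕ) < p' then (i : ℕ) else i + t') ∧
      listMinor k X (List.range p ++ List.range' (p + t) (k - p))
        (List.range p' ++ List.range' (p' + t') (k - p')) =
      impulseResponse (systemA A (k - p)) (systemB A c (k - p) β) (systemC A c (k - p)) (t + 1) := by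
    intro p t p' t' hp hp' ht'
    refine ⟨fun i => ⟨if (i : ℕ) < p' then (i : ℕ) else i + t', by split_ifs <;> omega⟩,
      fun _ => rfl, ?_⟩
    -- A zero-based shift `t` of the row block corresponds to time `t + 1`, and `k + t` rows just
    -- contain it.
    rw [← det_obsMatrix_submatrix (N := k + t) A c hu p (n - p) (k - p) (by omega) (by omega) (by omega) _
      (t + 1) (fun i => ⟨if (i : ℕ) < p then (i : ℕ) else i + t, by split_ifs <;> omega⟩)
      (fun _ => rfl)]
    unfold listMinor
    congr 1
    ext i j
    have hj : (if (j : ℕ) < p' then (j : ℕ) else j + t') < n := by split_ifs <;> omega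
    rw [Matrix.of_apply, getD_segments hp i.2, getD_segments hp' j.2]
    simp only [hX, hj, dif_pos]
    rfl
  intro u _ hvar
  rw [variation_le_iff] at hvar ⊢
  have hcast : ∀ e : ℕ∞, e ≤ ((k - 1 : ℕ) : ℕ∞) ↔ e < k := by
    intro e
    cases e with
    | top => simp
    | coe m =>
      rw [Nat.cast_le, Nat.cast_lt]
      omega
  rw [hcast] at hvar ⊢
  have hO : (obsOperator A c) u = fun s : ℕ => ∑ j : Fin n, u j * X s j := by
    funext s
    change c ⬝ᵥ ((A ^ s) *ᵥ u) = _
    rw [Matrix.dotProduct_mulVec]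
    refine Finset.sum_congr rfl fun j _ => ?_
    simp only [hX, j.2, dif_pos, mul_comm]
  rw [hO]
  refine encard_signChanges_lt_of_minors hk hkn X σ ?_ ?_ u hvar
  · intro p t p' t' hp hp' ht' hz
    obtain ⟨β, hβ, he⟩ := hminor p t p' t' hp hp' ht'
    rw [he]
    exact (hσ (k - p) (by omega) (by omega) β (isPrescribed_of_val_eq hp' ht' β hβ) (t + 1)
      (by omega)).1 (not_isExceptional_of_val_eq hp' β hβ hz)
  · intro p t t' hp ht'
    obtain ⟨β, hβ, he⟩ := hminor p t 0 t' hp (by omega) ht'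
    simp only [List.range_zero, List.nil_append, zero_add, Nat.sub_zero] at he
    rw [he]
    exact (hσ (k - p) (by omega) (by omega) β (isPrescribed_of_val_eq (by omega) ht' β hβ) (t + 1)
      (by omega)).2

end
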